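/- **Conventions.** Curves are projective plane curves over $\mathbb{C}$, given by homogeneous equations. Let $n\ge 2$ and read indices cyclically modulo $n$. A *polycon* $\mathcal{P}$ consists of reduced curves $C_i=\mathcal V(c_i)\subset\mathbb{P}^2$ of degree one or two (*boundary components*) and points $v_{i,i+1}\in\mathbb{P}^2$ (*explicit vertices*), $1\le i\le n$, such that $C_i$ and $C_{i+1}$ meet transversally in $v_{i,i+1}$, no other boundary component contains $v_{i,i+1}$, and the two vertices $v_{i-1,i}\neq v_{i,i+1}$ on $C_i$ are distinct. The singular point of a singular conic $C_i$ is an *implicit vertex*; $V(\mathcal P)$ is the set of all explicit and implicit vertices. Put $C_{\mathcal P}=\bigcup_i C_i=\mathcal V(\prod_i c_i)$, $d=\deg \mathcal P=\deg C_{\mathcal P}$, and $R(\mathcal P)=\operatorname{sing}(C_{\mathcal P})\setminus V(\mathcal P)$ (*residual arrangement*). $\mathcal P$ is *nodal* if all singularities of the curve $\mathcal V(\prod_i c_i)$ are nodes. An *adjoint polynomial* of $\mathcal P$ is a nonzero form $\alpha$ of degree $d-3$ whose germ at each $p\in R(\mathcal P)$ lies in the conductor of the local ring $\mathcal O_{C_{\mathcal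 P},p}$ in its normalization; its zero locus $A=\mathcal V(\alpha)$ is an *adjoint curve* of $\mathcal P$. A curve $A'$ is a *contact curve* to a curve $A$ if there is a divisor $D$ on $A$, supported in the smooth locus of $A$, with $A'.A=2D$, i.e. the intersection multiplicity of $A'$ and $A$ at every point $p\in\mathbb P^2$ is twice the coefficient of $p$ in $D$. **Theorem.** Let $\mathcal P$ be a nodal polycon such that on each boundary component that is a pair of lines the two explicit vertices lie on different lines. Let $C_1$ be a boundary component of degree two, and let $L$ be the line through its two explicit vertices $v_{n1}$ and $v_{12}$. Assume that replacing $C_1$ by $L$ and keeping all other data yields again a polycon $\mathcal P'$, and that $L$ contains no implicit vertex of $\mathcal P'$. ($\mathcal P'$ need not be nodal.) Let $A$ be the adjoint curve of $\mathcal P$ and $A'$ the adjoint curve of $\mathcal P'$. Then $R(\mathcal P)\cap R(\mathcal P')$ is a finite set of smooth points of $A$, the curve $A'$ is a contact curve to $A$, and $$A'.A = 2\,\bigl(R(\mathcal P)\cap R(\mathcal P')\bigr),$$ where the finite set on the right is regarded as a reduced divisor on $A$. -/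

import Mathlib

open MvPolynomial

noncomputable section

namespace PlaneCurve

/-- The complex projective plane. -/
abbrev Point : Type := Projectivization ℂ (Fin 3 → ℂ)

/-- The polynomial ring `ℂ[x₀, x₁, x₂]`; a plane curve is given by a homogeneous form in it. -/
abbrev Form : Type := MvPolynomial (Fin 3) ℂ

/-- The curve `f = 0` passes through `p` (meaningful for homogeneous `f`). -/
def Passes (f : Form) (p : Point) : Prop := eval p.rep f = 0

/-- The gradient of `f` at the representative of `p`. -/
def grad (f : Form) (p : Point) : Fin 3 → ℂ := fun i => eval p.rep (pderiv i f)

/-- The Hessian matrix of `f` at the representative of `p`. -/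
def hessian (f : Form) (p : Point) : Matrix (Fin 3) (Fin 3) ℂ :=
  Matrix.of fun i j => eval p.rep (pderiv i (pderiv j f))

/-- `p` is a singular point of the curve `f = 0`. -/
def IsSingularAt (f : Form) (p : Point) : Prop := Passes f p ∧ grad f p = 0

/-- `p` is a smooth point of the curve `f = 0`. -/
def IsSmoothAt (f : Form) (p : Point) : Prop := Passes f p ∧ grad f p ≠ 0

/-- `p` is a node (ordinary double point) of `f = 0`. At a singular point the representative of `p`
lies in the kernel of the Hessian, so rank two says that the quadratic part of a local equation
is nondegenerate, i.e. has two distinct tangent directions. -/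
def IsNodeAt (f : Form) (p : Point) : Prop := IsSingularAt f p ∧ (hessian f p).rank = 2

/-- The curves `f = 0` and `g = 0` meet transversally at `p`. -/
def MeetTransversallyAt (f g : Form) (p : Point) : Prop :=
  Passes f p ∧ Passes g p ∧ LinearIndependent ℂ ![grad f p, grad g p]

/-- The homogeneous prime ideal of `p`: all polynomials vanishing on the line in `ℂ³` that `p`
represents, as the kernel of `xᵢ ↦ vᵢ T` for a vector `v` spanning that line. -/
def pointIdeal (p : Point) : Ideal Form :=
  RingHom.ker (aeval (fun i => Polynomial.C (p.rep i) * Polynomial.X) :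
    MvPolynomial (Fin 3) ℂ →ₐ[ℂ] Polynomial ℂ)

instance (p : Point) : (pointIdeal p).IsPrime := by
  unfold pointIdeal; exact RingHom.ker_isPrime _

/-- The localization of `ℂ[x₀, x₁, x₂]` at the homogeneous prime of `p`. It is the local ring of the
projective plane at `p` up to adjoining one free unit (the scaling coordinate). -/
abbrev LocalRing (p : Point) : Type := Localization.AtPrime (pointIdeal p)

/-- The intersection multiplicity of `f = 0` and `g = 0` at `p`: the length of the localization of
`ℂ[x₀, x₁, x₂] / (f, g)` at the homogeneous prime of `p`. It is `⊤` if the curves share a component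
through `p`, and `0` if one of them does not pass through `p`. -/
def intersectionMultiplicity (f g : Form) (p : Point) : ℕ∞ :=
  Module.length (LocalRing p)
    (LocalRing p ⧸ Ideal.span {algebraMap Form (LocalRing p) f, algebraMap Form (LocalRing p) g})

/-- The local ring of the curve `F = 0` at `p` (with the scaling coordinate adjoined). -/
abbrev CurveLocalRing (F : Form) (p : Point) : Type :=
  LocalRing p ⧸ Ideal.span {algebraMap Form (LocalRing p) F}

/-- The conductor of a ring `A` in its normalization, the integral closure `B` of `A` in its total
ring of fractions: the ideal of all `a` in `A` with `a B ⊆ A`. -/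
def conductorIdeal (A : Type) [CommRing A] : Ideal A :=
  (Subalgebra.toSubmodule (⊥ : Subalgebra A (FractionRing A))).colon
    (integralClosure A (FractionRing A) : Set (FractionRing A))

/-- The germ of the form `f` on the curve `F = 0` at `p` lies in the conductor of the
normalization. -/
def InConductorAt (F f : Form) (p : Point) : Prop :=
  Ideal.Quotient.mk (Ideal.span {algebraMap Form (LocalRing p) F})
    (algebraMap Form (LocalRing p) f) ∈ conductorIdeal (CurveLocalRing F p)

/-- `D` is the contact divisor of the curve `f' = 0` on the curve `f = 0`: `D` is a divisor on
`f = 0` supported at smooth points of that curve, and `f' . f = 2 D`. (Such a divisor is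
automatically effective, hence the coefficients in `ℕ`.) -/
structure IsContactDivisor (f' f : Form) (D : Point →₀ ℕ) : Prop where
  smooth : ∀ p ∈ D.support, IsSmoothAt f p
  eq_two_mul : ∀ p, intersectionMultiplicity f' f p = ((2 * D p : ℕ) : ℕ∞)

/-- `f' = 0` is a contact curve to `f = 0`. -/
def IsContactCurve (f' f : Form) : Prop := ∃ D : Point →₀ ℕ, IsContactDivisor f' f D

/-- The sum of the points of a finite set, as a divisor. -/
def pointDivisor (s : Finset Point) : Point →₀ ℕ := ∑ p ∈ s, Finsupp.single p 1

end PlaneCurve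

open PlaneCurve

/-- A polycon with boundary components `C_i : c i = 0`, for `i` in `ℤ/n`, and explicit vertices
`v i = v_{i,i+1}`. Indices are cyclic. -/
structure Polycon (n : ℕ) [NeZero n] where
  two_le : 2 ≤ n
  c : Fin n → Form
  v : Fin n → Point
  degree_c : ∀ i, (c i).IsHomogeneous 1 ∨ (c i).IsHomogeneous 2
  reduced_c : ∀ i, Squarefree (c i)
  transversal : ∀ i, MeetTransversallyAt (c i) (c (i + 1)) (v i)
  not_passes : ∀ i j, j ≠ i → j ≠ i + 1 → ¬ Passes (c j) (v i)
  /-- The two explicit vertices on a component are distinct (automatic for `n ≥ 3`). -/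
  vertex_ne : ∀ i, v (i - 1) ≠ v i

namespace Polycon

variable {n : ℕ} [NeZero n]

/-- The equation of the algebraic boundary. -/
def boundary (P : Polycon n) : Form := ∏ i, P.c i

/-- The degree of the polycon. -/
def degree (P : Polycon n) : ℕ := P.boundary.totalDegree

/-- The explicit vertices and the implicit vertices (singular points of singular conics among the
boundary components). -/
def vertices (P : Polycon n) : Set Point :=
  Set.range P.v ∪ {p | ∃ i, IsSingularAt (P.c i) p}

/-- The residual arrangement. -/
def residual (P : Polycon n) : Set Point := {p | IsSingularAt P.boundary p} \ P.vertices

/-- All singular points of the algebraic boundary are nodes. -/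
def IsNodal (P : Polycon n) : Prop :=
  ∀ p, IsSingularAt P.boundary p → IsNodeAt P.boundary p

/-- On a boundary component that is a pair of lines, the two explicit vertices lie on different
lines: no line contained in a conic component passes through both of them. -/
def SeparatesVertices (P : Polycon n) : Prop :=
  ∀ i, (P.c i).IsHomogeneous 2 → ∀ l : Form, l.IsHomogeneous 1 → l ∣ P.c i →
    ¬ (Passes l (P.v (i - 1)) ∧ Passes l (P.v i))

/-- An implicit vertex lies on no other boundary component. -/
def ImplicitVerticesFree (P : Polycon n) : Prop :=
  ∀ i p, IsSingularAt (P.c i) p → ∀ j, j ≠ i → ¬ Passes (P.c j) p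

/-- `α` is a (nonzero) adjoint polynomial of `P`, i.e. an equation of an adjoint curve: a form of
degree `deg P - 3` that lies in the conductor of the desingularization of the algebraic boundary in
the residual arrangement. This desingularization is the normalization near residual points and an
isomorphism elsewhere, and forms of degree `deg P - 3` on the plane and on the boundary curve are
the same. -/
structure IsAdjoint (P : Polycon n) (α : Form) : Prop where
  ne_zero : α ≠ 0
  homogeneous : ∃ e, e + 3 = P.degree ∧ α.IsHomogeneous e
  conductor : ∀ p ∈ P.residual, InConductorAt P.boundary α p

/-- `P'` arises from `P` by replacing the conic component with index `k` by a line and keeping all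
other data. As `P'` is a polycon, that line passes through the two vertices `v (k - 1)`, `v k`. -/
structure IsLineReplacement (P P' : Polycon n) (k : Fin n) : Prop where
  conic : (P.c k).IsHomogeneous 2
  line : (P'.c k).IsHomogeneous 1
  other : ∀ i, i ≠ k → P'.c i = P.c i
  vertex : P'.v = P.v

end Polycon

end

/-! Write `c` and `l` for the conic and the line replacing it, and `g` for the product of the other
components, so that the boundaries are `c g` and `l g`. The theorem follows from one identity
(`Polycon.IsLineReplacement.exists_relation`): `α l - r α' c = μ g` with nonzero constants `r`, `μ`.

The identity comes from restricting an adjoint to one irreducible component `E` of degree `δ ≤ 2`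
(`AdjointEdge.exists_relation`). Such an `E` has a polynomial parametrization (`Chart`). Let `h` be
the rest of the boundary. Where `E` meets `h` outside its two vertices, the conductor lies in the
ideal `(E, h)` (`mem_span_of_mem_conductorIdeal`), so `α` restricted to `E` vanishes at least to the
order of `h`; at the vertices `h` has simple zeros. The degrees leave no room: `α (t - t₁)(t - t₂) =
κ h` on `E`, with `κ` constant. Hence `α` vanishes at one vertex of `E` iff at both iff `E ∣ α`. In
a line pair each line is an edge of its own, ending at the implicit vertex. Around the cycle, an
adjoint through a single vertex would be divisible by the whole boundary, whose degree is too large;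
so every `κ` is nonzero.

On each common component, `α l` and `α' c` are therefore proportional. The ratios agree at the
shared vertices, so `g` divides some `α l - r α' c`, a nonzero form of the same degree.

At a common zero of `α` and `α'`, `g` vanishes. If `g` is singular there, the point is residual for
both polycons, because adjoints avoid vertices. If not, `c` vanishes too, and differentiating the
identity contradicts the transversality of `α` to a branch of the nodal boundary. At a point
residual for both, `c` is a unit and `g` is a unit times two branches `E E'`, both transversal to
`α`; so `(α, α') = (α, E E')` has colength two. -/

namespace PlaneCurve

/-! ### Forms, gradients and nodes -/

/-- The gradient of a form at a vector. -/
noncomputable def gradAt (f : Form) (x : Fin 3 → ℂ) : Fin 3 → ℂ := fun i => eval x (pderiv i f)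

theorem grad_eq_gradAt (f : Form) (p : Point) : grad f p = gradAt f p.rep := rfl

/-- The target algebra is arbitrary since the scaling factor will be a number, a constant polynomial
or a linear form. -/
theorem aeval_mul_of_isHomogeneous {S : Type*} [CommRing S] [Algebra ℂ S] {f : Form} {n : ℕ}
    (hf : f.IsHomogeneous n) (u : S) (b : Fin 3 → S) :
    aeval (fun i => u * b i) f = u ^ n * aeval b f := by
  rw [aeval_def, aeval_def, eval₂_eq, eval₂_eq, Finset.mul_sum]
  refine Finset.sum_congr rfl fun d hd => ?_
  have : d.degree = n := by
    by_contra h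
    exact (mem_support_iff.mp hd) (hf.coeff_eq_zero h)
  simp only [mul_pow, Finset.prod_mul_distrib]
  rw [Finset.prod_pow_eq_pow_sum, ← this, Finsupp.degree_apply]
  ring

theorem eval_smul_of_isHomogeneous {f : Form} {n : ℕ} (hf : f.IsHomogeneous n) (s : ℂ)
    (x : Fin 3 → ℂ) : eval (s • x) f = s ^ n * eval x f :=
  aeval_mul_of_isHomogeneous hf s x

theorem euler_dotProduct {f : Form} {n : ℕ} (hf : f.IsHomogeneous n) (x : Fin 3 → ℂ) :
    gradAt f x ⬝ᵥ x = n * eval x f := by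
  have := congrArg (eval x) hf.sum_X_mul_pderiv
  simp only [map_sum, map_mul, eval_X, nsmul_eq_mul, map_natCast] at this
  rw [dotProduct, ← this]
  exact Finset.sum_congr rfl fun i _ => mul_comm _ _

theorem gradAt_smul {f : Form} {n : ℕ} (hf : f.IsHomogeneous n) (s : ℂ) (x : Fin 3 → ℂ) :
    gradAt f (s • x) = s ^ (n - 1) • gradAt f x := by
  ext i
  simp [gradAt, eval_smul_of_isHomogeneous (hf.pderiv (i := i))]

theorem gradAt_mul (f g : Form) (x : Fin 3 → ℂ) :
    gradAt (f * g) x = eval x f • gradAt g x + eval x g • gradAt f x := by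
  ext i
  simp [gradAt, Derivation.leibniz]

theorem hessian_mul {f g : Form} {p : Point} (hf : Passes f p) (hg : Passes g p) :
    hessian (f * g) p = Matrix.vecMulVec (grad f p) (grad g p) +
      Matrix.vecMulVec (grad g p) (grad f p) := by
  ext i j
  simp only [hessian, Matrix.of_apply, Derivation.leibniz, smul_eq_mul, map_add, map_mul,
    Matrix.add_apply, Matrix.vecMulVec_apply, grad]
  unfold Passes at hf hg
  rw [hf, hg]
  ring

theorem Passes.mul_left {f : Form} {p : Point} (g : Form) (hf : Passes f p) : Passes (f * g) p := by
  simp_all [Passes]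

theorem passes_mul_iff {f g : Form} {p : Point} :
    Passes (f * g) p ↔ Passes f p ∨ Passes g p := by simp [Passes]

theorem passes_prod_iff {ι : Type*} {s : Finset ι} {f : ι → Form} {p : Point} :
    Passes (∏ i ∈ s, f i) p ↔ ∃ i ∈ s, Passes (f i) p := by
  simp [Passes, Finset.prod_eq_zero_iff]

theorem isSingularAt_mul {f g : Form} {p : Point} (hf : Passes f p) (hg : Passes g p) :
    IsSingularAt (f * g) p := by
  refine ⟨hf.mul_left g, ?_⟩
  unfold Passes at hf hg
  rw [grad_eq_gradAt, gradAt_mul, hf, hg]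
  simp

/-- If one vector is a multiple of the other, the symmetrized product is a multiple of a single
dyad. -/
theorem rank_vecMulVec_add_le_one {a b : Fin 3 → ℂ} (h : ¬ LinearIndependent ℂ ![a, b]) :
    (Matrix.vecMulVec a b + Matrix.vecMulVec b a).rank ≤ 1 := by
  rw [LinearIndependent.pair_iff] at h
  push Not at h
  obtain ⟨s, t, hst, h⟩ := h
  by_cases hs : s = 0
  · have ht := h hs
    have hb : b = 0 := by simpa [hs, ht] using hst
    simp [hb]
  · have ha : a = (-(t / s)) • b := by
      have : s • a = (-t) • b := by
        rw [neg_smul]; exact eq_neg_of_add_eq_zero_left hst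
      rw [neg_div', div_eq_inv_mul, mul_smul, ← this, smul_smul, inv_mul_cancel₀ hs, one_smul]
    have : Matrix.vecMulVec a b + Matrix.vecMulVec b a
        = Matrix.vecMulVec ((2 * -(t / s)) • b) b := by
      ext i j
      rw [ha]
      simp [Matrix.vecMulVec_apply]
      ring
    rw [this]
    exact Matrix.rank_vecMulVec_le _ _

/-- At a node, the two local factors of the curve have independent gradients. -/
theorem IsNodeAt.linearIndependent {f g : Form} {p : Point} (h : IsNodeAt (f * g) p)
    (hf : Passes f p) (hg : Passes g p) : LinearIndependent ℂ ![grad f p, grad g p] := by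
  by_contra hc
  have := rank_vecMulVec_add_le_one hc
  rw [← hessian_mul hf hg, h.2] at this
  omega

/-- Nullstellensatz: the ideal `(E)` is prime, hence radical. -/
theorem dvd_of_forall_eval_eq_zero {E f : Form} (hE : Prime E)
    (h : ∀ x, eval x E = 0 → eval x f = 0) : E ∣ f := by
  have hp : (Ideal.span {E}).IsPrime := (Ideal.span_singleton_prime hE.ne_zero).2 hE
  rw [← Ideal.mem_span_singleton, ← hp.radical, ← vanishingIdeal_zeroLocus_eq_radical (K := ℂ)]
  intro x hx
  have := hx E (Ideal.mem_span_singleton_self E)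
  rw [aeval_eq_eval] at this ⊢
  exact h x this

/-! ### Derivatives along parametrized curves, and linear algebra in `ℂ³` -/

theorem derivative_aeval (φ : Fin 3 → Polynomial ℂ) (f : Form) :
    Polynomial.derivative (aeval φ f) =
      ∑ i, aeval φ (pderiv i f) * Polynomial.derivative (φ i) := by
  induction f using MvPolynomial.induction_on with
  | C a => simp [Polynomial.algebraMap_eq]
  | add p q hp hq => simp [hp, hq, add_mul, Finset.sum_add_distrib]
  | mul_X p i hp =>
    simp only [map_mul, aeval_X, Polynomial.derivative_mul, hp, Derivation.leibniz, pderiv_X,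
      smul_eq_mul, map_add, add_mul, Finset.sum_add_distrib]
    rw [add_comm]
    congr 1
    · rw [Finset.sum_eq_single i]
      · simp
      · intro j _ hj; simp [hj.symm]
      · simp
    · rw [Finset.sum_mul]
      exact Finset.sum_congr rfl fun j _ => by ring

theorem eval_aeval (φ : Fin 3 → Polynomial ℂ) (f : Form) (t : ℂ) :
    (aeval φ f).eval t = eval (fun i => (φ i).eval t) f := by
  induction f using MvPolynomial.induction_on with
  | C a => simp [Polynomial.algebraMap_eq]
  | add p q hp hq => simp [hp, hq]
  | mul_X p i hp => simp [hp]

theorem eval_derivative_aeval (φ : Fin 3 → Polynomial ℂ) (f : Form) (t : ℂ) :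
    (Polynomial.derivative (aeval φ f)).eval t =
      gradAt f (fun i => (φ i).eval t) ⬝ᵥ fun i => (Polynomial.derivative (φ i)).eval t := by
  rw [derivative_aeval, Polynomial.eval_finsetSum]
  simp [dotProduct, gradAt, eval_aeval]

/-- Two functionals that vanish on a common plane are dependent. -/
theorem dotProduct_ne_zero_of_linearIndependent {a b u v : Fin 3 → ℂ}
    (huv : LinearIndependent ℂ ![u, v]) (hab : LinearIndependent ℂ ![a, b])
    (hau : a ⬝ᵥ u = 0) (hav : a ⬝ᵥ v = 0) (hbu : b ⬝ᵥ u = 0) : b ⬝ᵥ v ≠ 0 := by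
  intro hbv
  let A : Matrix (Fin 2) (Fin 3) ℂ := Matrix.of ![a, b]
  let B : Matrix (Fin 2) (Fin 3) ℂ := Matrix.of ![u, v]
  have hA : A.rank = 2 := by simpa using LinearIndependent.rank_matrix (M := A) hab
  have hB : B.transpose.rank = 2 := by
    rw [Matrix.rank_transpose]
    simpa using LinearIndependent.rank_matrix (M := B) huv
  have h0 : A * B.transpose = 0 := by
    ext i j
    have : (A * B.transpose) i j = A i ⬝ᵥ B j := rfl
    rw [this]
    fin_cases i <;> fin_cases j <;> simpa [A, B]
  -- Two rank-two matrices with zero product through a space of dimension three: `2 + 2 ≤ 3`.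
  have := Matrix.rank_add_rank_le_card_of_mul_eq_zero h0
  rw [hA, hB] at this
  simp at this

/-- A functional vanishing at `v ≠ 0` is a combination of two independent ones that do. -/
theorem exists_eq_add_smul_of_dotProduct_eq_zero {a b ξ v : Fin 3 → ℂ} (hv : v ≠ 0)
    (hab : LinearIndependent ℂ ![a, b]) (ha : a ⬝ᵥ v = 0) (hb : b ⬝ᵥ v = 0) (hξ : ξ ⬝ᵥ v = 0) :
    ∃ r s : ℂ, ξ = r • a + s • b := by
  by_contra hc
  have hind : LinearIndependent ℂ ![ξ, a, b] := by
    refine (linearIndependent_finCons (x := ξ) (v := ![a, b])).2 ⟨hab, fun hmem => hc ?_⟩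
    simp only [Matrix.range_cons, Matrix.range_empty, Set.union_empty, Set.singleton_union] at hmem
    obtain ⟨r, s, h⟩ := Submodule.mem_span_pair.1 hmem
    exact ⟨r, s, h.symm⟩
  have hu : IsUnit (Matrix.of ![ξ, a, b]) := Matrix.linearIndependent_rows_iff_isUnit.1 hind
  refine hv (Matrix.mulVec_injective_iff_isUnit.2 hu ?_)
  rw [Matrix.mulVec_zero]
  ext i
  have : ((Matrix.of ![ξ, a, b]).mulVec v) i = (Matrix.of ![ξ, a, b]) i ⬝ᵥ v := rfl
  rw [this]
  fin_cases i <;> simpa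

/-! ### The local ring of a point -/

theorem eval_aeval_pointIdeal (f : Form) (p : Point) (t : ℂ) :
    (aeval (fun i => Polynomial.C (p.rep i) * Polynomial.X) f : Polynomial ℂ).eval t =
      eval (t • p.rep) f := by
  rw [eval_aeval]
  refine congrArg (fun x => eval x f) (funext fun i => ?_)
  rw [Polynomial.eval_mul, Polynomial.eval_C, Polynomial.eval_X, Pi.smul_apply, smul_eq_mul,
    mul_comm]

theorem mem_pointIdeal_iff {f : Form} {p : Point} :
    f ∈ pointIdeal p ↔ ∀ t : ℂ, eval (t • p.rep) f = 0 := by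
  rw [pointIdeal, RingHom.mem_ker]
  constructor
  · intro h t
    rw [← eval_aeval_pointIdeal]
    exact (congrArg (Polynomial.eval t) h).trans Polynomial.eval_zero
  · intro h
    exact Polynomial.funext fun t =>
      (eval_aeval_pointIdeal f p t).trans ((h t).trans Polynomial.eval_zero.symm)

/-- Denominators in the local ring need not be homogeneous, so they may vanish at the chosen
representative; a nonzero polynomial in the scaling parameter still has a nonzero non-root. -/
theorem exists_eval_smul_ne_zero {f : Form} {p : Point} (hf : f ∉ pointIdeal p) :
    ∃ t : ℂ, t ≠ 0 ∧ eval (t • p.rep) f ≠ 0 := by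
  by_contra! h
  refine hf ((RingHom.mem_ker).2 (Polynomial.eq_zero_of_infinite_isRoot _ ?_))
  refine Set.Infinite.mono (s := {(0 : ℂ)}ᶜ) (fun t ht => ?_) (Set.finite_singleton 0).infinite_compl
  exact (eval_aeval_pointIdeal f p t).trans (h t ht)

theorem notMem_pointIdeal {f : Form} {p : Point} (h : ¬ Passes f p) : f ∉ pointIdeal p :=
  fun hf => h (by simpa [Passes] using mem_pointIdeal_iff.1 hf 1)

theorem isUnit_algebraMap {f : Form} {p : Point} (h : f ∉ pointIdeal p) :
    IsUnit (algebraMap Form (LocalRing p) f) :=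
  (IsLocalization.AtPrime.isUnit_to_map_iff (LocalRing p) (pointIdeal p) f).2 h

theorem algebraMap_localRing_injective (p : Point) :
    Function.Injective (algebraMap Form (LocalRing p)) :=
  IsLocalization.injective _ (pointIdeal p).primeCompl_le_nonZeroDivisors

/-- Coprime polynomials stay coprime in the local ring of a point. -/
theorem algebraMap_dvd_of_dvd_mul {E h : Form} {p : Point} (hrel : IsRelPrime h E)
    {r : LocalRing p} (H : algebraMap Form (LocalRing p) h ∣ algebraMap Form (LocalRing p) E * r) :
    algebraMap Form (LocalRing p) h ∣ r := by
  obtain ⟨q, hq⟩ := H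
  obtain ⟨⟨r0, s⟩, hr⟩ := IsLocalization.surj (pointIdeal p).primeCompl r
  obtain ⟨⟨q0, t⟩, ht⟩ := IsLocalization.surj (pointIdeal p).primeCompl q
  simp only at hr ht
  have h1 : E * (r0 * t) = h * (q0 * s) := by
    apply algebraMap_localRing_injective p
    simp only [map_mul]
    rw [← hr, ← ht]
    linear_combination (algebraMap Form (LocalRing p) s) * (algebraMap Form (LocalRing p) t) * hq
  have h2 : h ∣ r0 * t := hrel.dvd_of_dvd_mul_left ⟨_, h1⟩
  have hu : IsUnit (algebraMap Form (LocalRing p) s * algebraMap Form (LocalRing p) t) :=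
    (IsLocalization.map_units _ s).mul (IsLocalization.map_units _ t)
  refine hu.dvd_mul_right.1 ?_
  have := map_dvd (algebraMap Form (LocalRing p)) h2
  rw [map_mul, ← hr] at this
  convert this using 1
  ring

/-! ### The conductor at a reducible point -/

theorem isIntegral_of_sq_sub_self_eq_zero {A B : Type*} [CommRing A] [CommRing B] [Algebra A B]
    {y : B} (hy : y ^ 2 - y = 0) : IsIntegral A y := by
  refine ⟨Polynomial.X ^ 2 - Polynomial.X, ?_, ?_⟩
  · nontriviality A
    exact Polynomial.monic_X_pow_sub (by rw [Polynomial.degree_X]; norm_num)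
  · simpa using hy

/-- The conductor of a reducible hypersurface is contained in the ideal generated by two
complementary factors of its equation. -/
theorem mem_span_of_mem_conductorIdeal {R : Type} [CommRing R] [IsDomain R] {e g a f : R}
    (hf : f = e * g) (hg0 : g ≠ 0) (hge : ∀ r, g ∣ e * r → g ∣ r) (heg' : ∀ r, e ∣ g * r → e ∣ r)
    (H : Ideal.Quotient.mk (Ideal.span {f}) a ∈ conductorIdeal (R ⧸ Ideal.span {f})) :
    a ∈ Ideal.span {e, g} := by
  let A := R ⧸ Ideal.span {f}
  let π : R →+* A := Ideal.Quotient.mk _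
  have hπ : ∀ r, π r = 0 ↔ e * g ∣ r := by
    intro r
    rw [← hf]
    exact Ideal.Quotient.eq_zero_iff_dvd _ _
  -- On each of the two pieces `e = 0` and `g = 0`, the sum `e + g` restricts to the equation of the
  -- other piece.
  have hx : π (e + g) ∈ nonZeroDivisors A := by
    refine mem_nonZeroDivisors_iff_right.2 fun z hz => ?_
    obtain ⟨r, rfl⟩ := Ideal.Quotient.mk_surjective z
    change π r * π (e + g) = 0 at hz
    change π r = 0
    rw [← map_mul, hπ] at hz
    rw [hπ]
    obtain ⟨s, hs⟩ := hz
    obtain ⟨r', rfl⟩ := hge r ⟨e * s - r, by linear_combination hs⟩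
    obtain ⟨r'', rfl⟩ := heg' r' ⟨s - r', mul_left_cancel₀ hg0 (by linear_combination hs)⟩
    exact ⟨r'', by ring⟩
  have heg : π e * π g = 0 := by rw [← map_mul, hπ]
  let B := FractionRing A
  have hinj : Function.Injective (algebraMap A B) := IsFractionRing.injective A B
  let x : nonZeroDivisors A := ⟨π (e + g), hx⟩
  -- The fraction `g / (e + g)` is 1 on `e = 0` and 0 on `g = 0`. It is an idempotent, hence
  -- integral, so the conductor must multiply it into the ring.
  let y : B := IsLocalization.mk' B (π g) x
  have hyx : y * algebraMap A B (π (e + g)) = algebraMap A B (π g) :=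
    IsLocalization.mk'_spec B (π g) x
  have hxu : IsUnit (algebraMap A B (π (e + g))) := IsLocalization.map_units B x
  have hy : y ^ 2 - y = 0 := by
    have h1 : π g * π g - π g * π (e + g) = 0 := by
      rw [map_add]; linear_combination - heg
    have h2 := congrArg (algebraMap A B) h1
    rw [map_sub, map_mul, map_mul, map_zero, ← hyx] at h2
    have h3 : (y ^ 2 - y) * (algebraMap A B (π (e + g)) * algebraMap A B (π (e + g))) = 0 := by
      linear_combination h2
    exact (hxu.mul hxu).mul_left_eq_zero.1 h3
  have hyint : y ∈ (integralClosure A B : Set B) := isIntegral_of_sq_sub_self_eq_zero hy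
  have hmem := Submodule.mem_colon.1 H y hyint
  obtain ⟨b, hb⟩ := Algebra.mem_bot.1 ((Subalgebra.mem_toSubmodule _).1 hmem)
  have h4 : b * π (e + g) = π a * π g := by
    apply hinj
    rw [map_mul, map_mul, hb, Algebra.smul_def, mul_assoc, hyx]
  obtain ⟨b0, rfl⟩ := Ideal.Quotient.mk_surjective b
  change π b0 * π (e + g) = π a * π g at h4
  rw [← map_mul, ← map_mul, ← sub_eq_zero, ← map_sub, hπ] at h4
  obtain ⟨s, hs⟩ := h4
  -- Modulo `g` the relation reads `g ∣ e b0`. Dividing it by `g` then exhibits `a` in `(e, g)`.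
  obtain ⟨b1, rfl⟩ := hge b0 ⟨e * s + a - b0, by linear_combination hs⟩
  rw [Ideal.mem_span_pair]
  exact ⟨b1 - s, b1, mul_left_cancel₀ hg0 (by linear_combination hs)⟩

theorem InConductorAt.mem_span {E h α : Form} {p : Point} (hrel : IsRelPrime E h) (hh : h ≠ 0)
    (H : InConductorAt (E * h) α p) :
    algebraMap Form (LocalRing p) α ∈
      Ideal.span {algebraMap Form (LocalRing p) E, algebraMap Form (LocalRing p) h} :=
  mem_span_of_mem_conductorIdeal (map_mul _ _ _)
    ((map_ne_zero_iff _ (algebraMap_localRing_injective p)).2 hh)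
    (fun _ => algebraMap_dvd_of_dvd_mul hrel.symm) (fun _ => algebraMap_dvd_of_dvd_mul hrel) H

theorem exists_mul_eq_of_mem_span {E h α : Form} {p : Point}
    (H : algebraMap Form (LocalRing p) α ∈
      Ideal.span {algebraMap Form (LocalRing p) E, algebraMap Form (LocalRing p) h}) :
    ∃ d a b : Form, d ∉ pointIdeal p ∧ d * α = a * E + b * h := by
  obtain ⟨a, b, hab⟩ := Ideal.mem_span_pair.1 H
  obtain ⟨⟨a0, c⟩, ha⟩ := IsLocalization.surj (pointIdeal p).primeCompl a
  obtain ⟨⟨b0, d⟩, hb⟩ := IsLocalization.surj (pointIdeal p).primeCompl b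
  refine ⟨c * d, a0 * d, b0 * c, (c * d).2, algebraMap_localRing_injective p ?_⟩
  rw [map_add, map_mul, map_mul, map_mul, map_mul, map_mul, map_mul, ← ha, ← hb, ← hab]
  ring

/-- Along a parametrized curve `E = 0`, a form in the ideal `(E, h)` of the local ring of a point
vanishes to at least the order of `h`. -/
theorem pow_dvd_aeval_of_mem_span {E h α : Form} {p : Point} {e m k : ℕ}
    (hα : α.IsHomogeneous e) (hE : E.IsHomogeneous k) (hh : h.IsHomogeneous m)
    (H : algebraMap Form (LocalRing p) α ∈
      Ideal.span {algebraMap Form (LocalRing p) E, algebraMap Form (LocalRing p) h})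
    {φ : Fin 3 → Polynomial ℂ} (hφ : aeval φ E = 0) {t s : ℂ} (hs : s ≠ 0)
    (hp : (fun i => (φ i).eval t) = s • p.rep) {N : ℕ}
    (hN : (Polynomial.X - Polynomial.C t) ^ N ∣ aeval φ h) :
    (Polynomial.X - Polynomial.C t) ^ N ∣ aeval φ α := by
  obtain ⟨d, a, b, hd, h1⟩ := exists_mul_eq_of_mem_span H
  obtain ⟨T, hT, hcd⟩ := exists_eval_smul_ne_zero hd
  -- Rescaling makes the chart pass through the multiple `T • p.rep` at which `d` is nonzero. It
  -- changes the restrictions of the homogeneous `α`, `E`, `h` only by nonzero constants.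
  let ψ : Fin 3 → Polynomial ℂ := fun i => Polynomial.C (T / s) * φ i
  have hψ : (fun i => (ψ i).eval t) = T • p.rep := by
    funext i
    have := congrFun hp i
    simp only [Pi.smul_apply, smul_eq_mul] at this
    simp only [ψ, Polynomial.eval_mul, Polynomial.eval_C, this, Pi.smul_apply, smul_eq_mul]
    field_simp
  have h2 : aeval ψ d * aeval ψ α = aeval ψ a * aeval ψ E + aeval ψ b * aeval ψ h := by
    rw [← map_mul, h1, map_add, map_mul, map_mul]
  have hα' : aeval ψ α = Polynomial.C ((T / s) ^ e) * aeval φ α := by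
    rw [Polynomial.C_pow, ← aeval_mul_of_isHomogeneous hα]
  have hE' : aeval ψ E = Polynomial.C ((T / s) ^ k) * aeval φ E := by
    rw [Polynomial.C_pow, ← aeval_mul_of_isHomogeneous hE]
  have hh' : aeval ψ h = Polynomial.C ((T / s) ^ m) * aeval φ h := by
    rw [Polynomial.C_pow, ← aeval_mul_of_isHomogeneous hh]
  rw [hα', hE', hh', hφ, mul_zero, mul_zero, zero_add, ← mul_assoc] at h2
  have h3 : (Polynomial.X - Polynomial.C t) ^ N ∣
      aeval ψ d * Polynomial.C ((T / s) ^ e) * aeval φ α := by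
    rw [h2]
    exact Dvd.dvd.mul_left (Dvd.dvd.mul_left hN _) _
  refine (Polynomial.prime_X_sub_C t).pow_dvd_of_dvd_mul_left N ?_ h3
  rw [Polynomial.dvd_iff_isRoot, Polynomial.IsRoot, Polynomial.eval_mul, Polynomial.eval_C,
    eval_aeval, hψ]
  exact mul_ne_zero hcd (pow_ne_zero _ (div_ne_zero hT hs))

/-! ### Transversal intersections and lengths -/

/-- Taylor expansion of a polynomial to first order. -/
theorem aeval_add_sub_mem_sq {S : Type*} [CommRing S] [Algebra ℂ S] {J : Ideal S}
    {a y : Fin 3 → S} (hy : ∀ i, y i ∈ J) (f : Form) :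
    aeval (fun i => a i + y i) f - aeval a f - ∑ i, y i * aeval a (pderiv i f) ∈ J ^ 2 := by
  induction f using MvPolynomial.induction_on with
  | C c => simp
  | add p q hp hq =>
    convert add_mem hp hq using 1
    simp only [map_add, mul_add, Finset.sum_add_distrib]
    ring
  | mul_X p j hp =>
    have hsum : ∑ i, y i * aeval a (pderiv i p) ∈ J :=
      sum_mem fun i _ => J.mul_mem_right _ (hy i)
    have h1 : (∑ i, y i * aeval a (pderiv i p)) * y j ∈ J ^ 2 := by
      rw [pow_two]; exact Ideal.mul_mem_mul hsum (hy j)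
    have h2 := (J ^ 2).mul_mem_right (a j + y j) hp
    convert add_mem h2 h1 using 1
    have h3 : ∑ i, y i * aeval a (pderiv i (p * X j)) =
        (∑ i, y i * aeval a (pderiv i p)) * a j + y j * aeval a p := by
      simp only [Derivation.leibniz, smul_eq_mul, map_add, map_mul, aeval_X, pderiv_X, mul_add,
        Finset.sum_add_distrib]
      rw [add_comm]
      congr 1
      · rw [Finset.sum_mul]
        exact Finset.sum_congr rfl fun i _ => by ring
      · rw [Finset.sum_eq_single j]
        · simp
        · intro i _ hi; simp [hi.symm]
        · simp
    rw [h3]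
    simp only [map_mul, aeval_X]
    ring

theorem mem_pointIdeal_of_passes {f : Form} {n : ℕ} (hf : f.IsHomogeneous n) {p : Point}
    (h : Passes f p) : f ∈ pointIdeal p :=
  mem_pointIdeal_iff.2 fun t => by rw [eval_smul_of_isHomogeneous hf, h, mul_zero]

/-- Two curves that meet transversally at `p` generate the maximal ideal of the local ring. -/
theorem span_eq_maximalIdeal {f g : Form} {m n : ℕ} (hf : f.IsHomogeneous m)
    (hg : g.IsHomogeneous n) {p : Point} (h : MeetTransversallyAt f g p) :
    Ideal.span {algebraMap Form (LocalRing p) f, algebraMap Form (LocalRing p) g} =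
      IsLocalRing.maximalIdeal (LocalRing p) := by
  obtain ⟨hfp, hgp, hind⟩ := h
  set M := IsLocalRing.maximalIdeal (LocalRing p) with hM
  have hmap : (pointIdeal p).map (algebraMap Form (LocalRing p)) = M :=
    Localization.AtPrime.map_eq_maximalIdeal
  have hmem : ∀ x ∈ pointIdeal p, algebraMap Form (LocalRing p) x ∈ M := fun x hx =>
    hmap ▸ Ideal.mem_map_of_mem _ hx
  refine le_antisymm ?_ ?_
  · rw [Ideal.span_le]
    rintro _ (rfl | rfl)
    · exact hmem _ (mem_pointIdeal_of_passes hf hfp)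
    · exact hmem _ (mem_pointIdeal_of_passes hg hgp)
  -- Nakayama: it suffices to generate the maximal ideal modulo its square.
  refine Submodule.le_of_le_smul_of_le_jacobson_bot (I := M) (IsNoetherian.noetherian _)
    (IsLocalRing.maximalIdeal_le_jacobson _) ?_
  set K : Ideal (LocalRing p) :=
    Ideal.span {algebraMap Form (LocalRing p) f, algebraMap Form (LocalRing p) g} ⊔ M • M with hK
  set v := p.rep with hv
  have hv0 : v ≠ 0 := p.rep_nonzero
  obtain ⟨j, hj⟩ := Function.ne_iff.1 hv0
  rw [Pi.zero_apply] at hj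
  -- The vector `a = u v` is the moving point on the line through `v` with the same `j`-th
  -- coordinate as `X`. The differences `y` vanish on that line, with `y j = 0`, and `u` is a unit
  -- there.
  let u : Form := X j * C (v j)⁻¹
  let a : Fin 3 → Form := fun i => u * C (v i)
  let y : Fin 3 → Form := fun i => X i - a i
  have hay : (fun i => a i + y i) = X := by funext i; simp [y]
  have hyI : ∀ i, y i ∈ pointIdeal p := by
    intro i
    rw [mem_pointIdeal_iff]
    intro t
    simp only [y, a, u, map_sub, map_mul, eval_X, eval_C, Pi.smul_apply, smul_eq_mul, ← hv]
    field_simp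
    ring
  have hu : u ∉ pointIdeal p := notMem_pointIdeal (by simp [Passes, u, ← hv, hj])
  have hyj : y j = 0 := by
    simp only [y, a, u]
    rw [mul_assoc, ← C_mul, inv_mul_cancel₀ hj]
    simp
  have expand : ∀ {q : Form} {k : ℕ}, q.IsHomogeneous k → Passes q p →
      q - u ^ (k - 1) * ∑ i, y i * C (grad q p i) ∈ pointIdeal p ^ 2 := by
    intro q k hq hqp
    have h1 := aeval_add_sub_mem_sq (a := a) hyI q
    have h2 : ∀ r : Form, aeval (fun i => (C (v i) : Form)) r = C (eval v r) := by
      intro r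
      rw [← aeval_eq_eval]
      exact aeval_algebraMap_apply (B := Form) v r
    have h3 : aeval a q = 0 := by
      rw [aeval_mul_of_isHomogeneous hq, h2]
      rw [show eval v q = 0 from hqp, C_0, mul_zero]
    rw [hay, aeval_X_left, AlgHom.id_apply, h3, sub_zero] at h1
    convert h1 using 2
    rw [Finset.mul_sum]
    refine Finset.sum_congr rfl fun i _ => ?_
    rw [aeval_mul_of_isHomogeneous (hq.pderiv (i := i)), h2]
    simp only [grad]
    ring
  have hM2 : ∀ x ∈ pointIdeal p ^ 2, algebraMap Form (LocalRing p) x ∈ K := by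
    intro x hx
    refine Ideal.mem_sup_right ?_
    have := Ideal.mem_map_of_mem (algebraMap Form (LocalRing p)) hx
    rwa [Ideal.map_pow, hmap, pow_two] at this
  have lin : ∀ {q : Form} {k : ℕ}, q.IsHomogeneous k → Passes q p →
      algebraMap Form (LocalRing p) q ∈ K →
      algebraMap Form (LocalRing p) (∑ i, y i * C (grad q p i)) ∈ K := by
    intro q k hq hqp hqK
    have h1 := K.sub_mem hqK (hM2 _ (expand hq hqp))
    rw [← map_sub, sub_sub_cancel, map_mul, map_pow] at h1
    exact (Ideal.unit_mul_mem_iff_mem K ((isUnit_algebraMap hu).pow _)).1 h1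
  have hfK := lin hf hfp (Ideal.mem_sup_left (Ideal.subset_span (by simp)))
  have hgK := lin hg hgp (Ideal.mem_sup_left (Ideal.subset_span (by simp)))
  have hyK : ∀ i, algebraMap Form (LocalRing p) (y i) ∈ K := by
    intro i
    have h0 : ∀ {q : Form} {k : ℕ}, q.IsHomogeneous k → Passes q p → grad q p ⬝ᵥ v = 0 := by
      intro q k hq hqp
      rw [grad_eq_gradAt, euler_dotProduct hq, show eval p.rep q = 0 from hqp, mul_zero]
    -- The functional with value `y i` on `y` kills `v`, so it is a combination of the two
    -- gradients, which kill `v` by Euler's formula and are independent by transversality.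
    obtain ⟨r, s, hrs⟩ := exists_eq_add_smul_of_dotProduct_eq_zero
      (ξ := Pi.single i 1 - (v i * (v j)⁻¹) • Pi.single j 1) hv0 hind (h0 hf hfp) (h0 hg hgp)
      (by simp [sub_dotProduct, hj])
    have h1 : y i = C r * ∑ l, y l * C (grad f p l) + C s * ∑ l, y l * C (grad g p l) := by
      rw [Finset.mul_sum, Finset.mul_sum, ← Finset.sum_add_distrib]
      have h2 : ∀ l, C r * (y l * C (grad f p l)) + C s * (y l * C (grad g p l)) =
          y l * C ((Pi.single i 1 - (v i * (v j)⁻¹) • Pi.single j 1 : Fin 3 → ℂ) l) := by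
        intro l
        rw [hrs]
        simp only [Pi.add_apply, Pi.smul_apply, smul_eq_mul, map_add, map_mul]
        ring
      simp only [h2]
      simp only [Pi.sub_apply, Pi.smul_apply, smul_eq_mul, map_sub, map_mul, mul_sub,
        Finset.sum_sub_distrib, Pi.single_apply, apply_ite (C (σ := Fin 3) (R := ℂ)), C_1, C_0,
        mul_ite, mul_one, mul_zero, Finset.sum_ite_eq', Finset.mem_univ,
        if_true, hyj]
      simp
    rw [h1, map_add, map_mul, map_mul]
    exact K.add_mem (K.mul_mem_left _ hfK) (K.mul_mem_left _ hgK)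
  change M ≤ K
  rw [← hmap, Ideal.map_le_iff_le_comap]
  intro q hq
  rw [Ideal.mem_comap]
  have h1 := aeval_add_sub_mem_sq (a := a) hyI q
  have h2 : aeval a q = 0 := by
    -- Evaluation at `u v` factors through the map `xᵢ ↦ vᵢ T` whose kernel is the point ideal.
    have hcomp : (aeval a : Form →ₐ[ℂ] Form) = (Polynomial.aeval u).comp
        (aeval (fun i => Polynomial.C (v i) * Polynomial.X)) := by
      refine algHom_ext fun i => ?_
      rw [AlgHom.comp_apply, aeval_X, aeval_X, map_mul, Polynomial.aeval_X, Polynomial.aeval_C,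
        mul_comm]
      rfl
    rw [hcomp, AlgHom.comp_apply]
    have h3 : (aeval (fun i => Polynomial.C (v i) * Polynomial.X) q : Polynomial ℂ) = 0 := hq
    rw [h3, map_zero]
  rw [hay, aeval_X_left, AlgHom.id_apply, h2, sub_zero] at h1
  have h4 := K.add_mem (hM2 _ h1) (a := _) (b := algebraMap Form (LocalRing p)
    (∑ i, y i * aeval a (pderiv i q))) (by
      rw [map_sum]
      exact sum_mem fun i _ => by rw [map_mul]; exact K.mul_mem_right _ (hyK i))
  rwa [← map_add, sub_add_cancel] at h4

/-- The length of `R / (a, b c)` when `(a, b)` and `(a, c)` are the maximal ideal. -/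
theorem length_quotient_span_mul {R : Type} [CommRing R] [IsDomain R] [IsLocalRing R] {a b c : R}
    (hb : b ≠ 0) (hab : Ideal.span {a, b} = IsLocalRing.maximalIdeal R)
    (hac : Ideal.span {a, c} = IsLocalRing.maximalIdeal R) (h : ∀ z, b ∣ a * z → b ∣ z) :
    Module.length R (R ⧸ Ideal.span {a, b * c}) = 2 := by
  have hone : Module.length R (R ⧸ IsLocalRing.maximalIdeal R) = 1 :=
    Module.length_eq_one_iff.2 (isSimpleModule_iff_isCoatom.2
      (IsLocalRing.maximalIdeal.isMaximal R).out)
  have hle1 : Ideal.span {a, c} ≤ Submodule.comap (LinearMap.mulLeft R b) (Ideal.span {a, b * c}) := by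
    rw [Ideal.span_le]
    rintro _ (rfl | rfl)
    · exact Ideal.mul_mem_left _ _ (Ideal.subset_span (by simp))
    · exact Ideal.subset_span (by simp)
  have hle2 : Ideal.span {a, b * c} ≤ Ideal.span {a, b} := by
    rw [Ideal.span_le]
    rintro _ (rfl | rfl)
    · exact Ideal.subset_span (by simp)
    · exact Ideal.mul_mem_right _ _ (Ideal.subset_span (by simp))
  -- Length is additive on `0 → R/(a,c) → R/(a,bc) → R/(a,b) → 0`, whose first map is multiplication
  -- by `b`; both ends are the residue field.
  let F : (R ⧸ Ideal.span {a, c}) →ₗ[R] (R ⧸ Ideal.span {a, b * c}) :=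
    Submodule.mapQ _ _ (LinearMap.mulLeft R b) hle1
  let G : (R ⧸ Ideal.span {a, b * c}) →ₗ[R] (R ⧸ Ideal.span {a, b}) :=
    Submodule.factor hle2
  have hlen := Module.length_eq_add_of_exact F G ?_ ?_ ?_
  · rw [hlen, hac, hab, hone]; norm_num
  · rw [← LinearMap.ker_eq_bot, LinearMap.ker_eq_bot']
    intro x hx
    obtain ⟨x, rfl⟩ := Submodule.Quotient.mk_surjective _ x
    rw [Submodule.mapQ_apply, Submodule.Quotient.mk_eq_zero] at hx
    rw [Submodule.Quotient.mk_eq_zero]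
    obtain ⟨z, w, hzw⟩ := Ideal.mem_span_pair.1 hx
    rw [LinearMap.mulLeft_apply] at hzw
    obtain ⟨z', rfl⟩ := h z ⟨x - w * c, by linear_combination hzw⟩
    exact Ideal.mem_span_pair.2 ⟨z', w, mul_left_cancel₀ hb (by linear_combination hzw)⟩
  · exact Submodule.factor_surjective hle2
  · intro x
    obtain ⟨x, rfl⟩ := Submodule.Quotient.mk_surjective _ x
    change (Submodule.Quotient.mk x : R ⧸ Ideal.span {a, b}) = 0 ↔ _
    rw [Submodule.Quotient.mk_eq_zero]
    constructor
    · intro hx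
      obtain ⟨z, w, rfl⟩ := Ideal.mem_span_pair.1 hx
      refine ⟨Submodule.Quotient.mk w, ?_⟩
      rw [Submodule.mapQ_apply, Submodule.Quotient.eq, LinearMap.mulLeft_apply]
      exact Ideal.mem_span_pair.2 ⟨-z, 0, by ring⟩
    · rintro ⟨y, hy⟩
      obtain ⟨y, rfl⟩ := Submodule.Quotient.mk_surjective _ y
      rw [Submodule.mapQ_apply, Submodule.Quotient.eq, LinearMap.mulLeft_apply] at hy
      have := (Ideal.span {a, b}).sub_mem (Ideal.mul_mem_right y _
        (Ideal.subset_span (show b ∈ ({a, b} : Set R) by simp))) (hle2 hy)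
      rwa [sub_sub_cancel] at this

/-! ### Polynomial charts of rational curves -/

/-- A polynomial parametrization of degree `δ` of the curve `E = 0`, injective, immersive and
surjective except for one point, its value at infinity. -/
structure Chart (E : Form) (δ : ℕ) where
  φ : Fin 3 → Polynomial ℂ
  natDegree_le : ∀ i, (φ i).natDegree ≤ δ
  comp_eq_zero : aeval φ E = 0
  indep : ∀ t : ℂ, LinearIndependent ℂ
    ![fun i => (φ i).eval t, fun i => (Polynomial.derivative (φ i)).eval t]
  inj : ∀ t t' s : ℂ, (fun i => (φ i).eval t) = s • (fun i => (φ i).eval t') → t = t'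
  cover : ∀ x : Fin 3 → ℂ, eval x E = 0 → ∃ s : ℂ,
    x = (s • fun i => (φ i).coeff δ) ∨ ∃ t : ℂ, x = s • fun i => (φ i).eval t

namespace Chart

variable {E : Form} {δ : ℕ}

/-- The point of the chart with parameter `t`, as a vector. -/
noncomputable def pt (C : Chart E δ) (t : ℂ) : Fin 3 → ℂ := fun i => (C.φ i).eval t

/-- The velocity of the chart at `t`. -/
noncomputable def vel (C : Chart E δ) (t : ℂ) : Fin 3 → ℂ :=
  fun i => (Polynomial.derivative (C.φ i)).eval t

/-- The value of the chart at infinity, as a vector. -/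
noncomputable def inf (C : Chart E δ) : Fin 3 → ℂ := fun i => (C.φ i).coeff δ

theorem eval_comp (C : Chart E δ) (f : Form) (t : ℂ) :
    (aeval C.φ f).eval t = eval (C.pt t) f := eval_aeval _ _ _

theorem eval_derivative_comp (C : Chart E δ) (f : Form) (t : ℂ) :
    (Polynomial.derivative (aeval C.φ f)).eval t = gradAt f (C.pt t) ⬝ᵥ C.vel t :=
  eval_derivative_aeval _ _ _

/-- The formal top coefficient records the value at the point at infinity, which lets degrees be
counted on the projective curve with one-variable polynomials. -/
theorem natDegree_comp_le_and_coeff (C : Chart E δ) {f : Form} {m : ℕ} (hf : f.IsHomogeneous m) :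
    (aeval C.φ f).natDegree ≤ δ * m ∧ (aeval C.φ f).coeff (δ * m) = eval C.inf f := by
  have hmon : ∀ d ∈ f.support, (∏ i, C.φ i ^ d i).natDegree ≤ δ * m ∧
      (∏ i, C.φ i ^ d i).coeff (δ * m) = ∏ i, C.inf i ^ d i := by
    intro d hd
    have hdeg : d.degree = m := by
      by_contra h
      exact (mem_support_iff.mp hd) (hf.coeff_eq_zero h)
    have hsum : d 0 + d 1 + d 2 = m := by
      rw [← hdeg, Finsupp.degree_eq_sum, Fin.sum_univ_three]
    have hd' : ∀ i, (C.φ i ^ d i).natDegree ≤ d i * δ := fun i =>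
      Polynomial.natDegree_pow_le_of_le _ (C.natDegree_le i)
    have hc' : ∀ i, (C.φ i ^ d i).coeff (d i * δ) = C.inf i ^ d i := fun i =>
      Polynomial.coeff_pow_of_natDegree_le (C.natDegree_le i)
    have hm : δ * m = d 0 * δ + d 1 * δ + d 2 * δ := by rw [← hsum]; ring
    rw [Fin.prod_univ_three, Fin.prod_univ_three, hm]
    have h01 := Polynomial.natDegree_mul_le_of_le (hd' 0) (hd' 1)
    refine ⟨Polynomial.natDegree_mul_le_of_le h01 (hd' 2), ?_⟩
    rw [Polynomial.coeff_mul_add_eq_of_natDegree_le h01 (hd' 2),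
      Polynomial.coeff_mul_add_eq_of_natDegree_le (hd' 0) (hd' 1), hc', hc', hc']
  have hexp : aeval C.φ f = ∑ d ∈ f.support, Polynomial.C (coeff d f) * ∏ i, C.φ i ^ d i := by
    rw [aeval_def, eval₂_eq']
    rfl
  rw [hexp]
  constructor
  · exact Polynomial.natDegree_sum_le_of_forall_le _ _ fun d hd =>
      (Polynomial.natDegree_C_mul_le _ _).trans (hmon d hd).1
  · rw [Polynomial.finsetSum_coeff, eval_eq']
    exact Finset.sum_congr rfl fun d hd => by rw [Polynomial.coeff_C_mul, (hmon d hd).2]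

theorem dvd_of_comp_eq_zero (C : Chart E δ) (hE : Prime E) {f : Form} {m : ℕ}
    (hf : f.IsHomogeneous m) (h : aeval C.φ f = 0) : E ∣ f := by
  refine dvd_of_forall_eval_eq_zero hE fun x hx => ?_
  obtain ⟨s, rfl | ⟨t, rfl⟩⟩ := C.cover x hx
  · rw [eval_smul_of_isHomogeneous hf]
    change s ^ m * eval C.inf f = 0
    rw [← (C.natDegree_comp_le_and_coeff hf).2, h, Polynomial.coeff_zero, mul_zero]
  · rw [eval_smul_of_isHomogeneous hf]
    change s ^ m * eval (C.pt t) f = 0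
    rw [← C.eval_comp, h, Polynomial.eval_zero, mul_zero]

theorem comp_eq_zero_of_dvd (C : Chart E δ) {f : Form} (h : E ∣ f) : aeval C.φ f = 0 := by
  obtain ⟨g, rfl⟩ := h
  rw [map_mul, C.comp_eq_zero, zero_mul]

/-- A point of `f = 0` cannot be the point at infinity, where `f` is nonzero, so it has a finite
parameter. -/
theorem exists_param (C : Chart E δ) {f : Form} {m : ℕ} (hf : f.IsHomogeneous m)
    (hinf : eval C.inf f ≠ 0) {p : Point} (hE : Passes E p) (hp : Passes f p) :
    ∃ t s : ℂ, s ≠ 0 ∧ C.pt t = s • p.rep := by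
  obtain ⟨s, h | ⟨t, h⟩⟩ := C.cover p.rep hE
  · have hs : s ≠ 0 := by rintro rfl; exact p.rep_nonzero (by rw [h, zero_smul])
    have : eval p.rep f = s ^ m * eval C.inf f := by
      conv_lhs => rw [h]
      exact eval_smul_of_isHomogeneous hf s _
    exact absurd (this.symm.trans hp) (mul_ne_zero (pow_ne_zero _ hs) hinf)
  · have hs : s ≠ 0 := by rintro rfl; exact p.rep_nonzero (by rw [h, zero_smul])
    exact ⟨t, s⁻¹, inv_ne_zero hs, by
      rw [h, smul_smul, inv_mul_cancel₀ hs, one_smul]; rfl⟩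

theorem eval_comp_eq_zero_iff (C : Chart E δ) {f : Form} {m : ℕ} (hf : f.IsHomogeneous m)
    {p : Point} {t s : ℂ} (hs : s ≠ 0) (hp : C.pt t = s • p.rep) :
    (aeval C.φ f).eval t = 0 ↔ Passes f p := by
  rw [C.eval_comp, hp, eval_smul_of_isHomogeneous hf, mul_eq_zero]
  exact ⟨fun h => h.resolve_left (pow_ne_zero _ hs), Or.inr⟩

theorem point_eq (C : Chart E δ) {p p' : Point} {t s s' : ℂ} (hs : s ≠ 0)
    (hp : C.pt t = s • p.rep) (hp' : C.pt t = s' • p'.rep) : p = p' := by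
  rw [← p.mk_rep, ← p'.mk_rep, Projectivization.mk_eq_mk_iff']
  refine ⟨s⁻¹ * s', ?_⟩
  rw [mul_smul, ← hp', hp, smul_smul, inv_mul_cancel₀ hs, one_smul]

theorem param_eq (C : Chart E δ) {p : Point} {t t' s s' : ℂ} (hs' : s' ≠ 0)
    (hp : C.pt t = s • p.rep) (hp' : C.pt t' = s' • p.rep) : t = t' := by
  refine C.inj t t' (s * s'⁻¹) ?_
  change C.pt t = (s * s'⁻¹) • C.pt t'
  rw [hp, hp', smul_smul, mul_assoc, inv_mul_cancel₀ hs', mul_one]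

theorem dotProduct_vel (C : Chart E δ) {f : Form} {m : ℕ} (hf : f.IsHomogeneous m)
    {p : Point} {t s : ℂ} (hp : C.pt t = s • p.rep) :
    (Polynomial.derivative (aeval C.φ f)).eval t = s ^ (m - 1) * (grad f p ⬝ᵥ C.vel t) := by
  rw [C.eval_derivative_comp, hp, gradAt_smul hf, smul_dotProduct, grad_eq_gradAt, smul_eq_mul]

theorem grad_dotProduct_vel_eq_zero (C : Chart E δ) {k : ℕ} (hE : E.IsHomogeneous k)
    {p : Point} {t s : ℂ} (hs : s ≠ 0) (hp : C.pt t = s • p.rep) : grad E p ⬝ᵥ C.vel t = 0 := by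
  have h := C.dotProduct_vel hE hp
  rw [C.comp_eq_zero, Polynomial.derivative_zero, Polynomial.eval_zero, eq_comm, mul_eq_zero] at h
  exact h.resolve_left (pow_ne_zero _ hs)

theorem grad_dotProduct_rep {f : Form} {m : ℕ} (hf : f.IsHomogeneous m) {p : Point}
    (hp : Passes f p) : grad f p ⬝ᵥ p.rep = 0 := by
  rw [grad_eq_gradAt, euler_dotProduct hf, show eval p.rep f = 0 from hp, mul_zero]

/-- A curve transversal to `E = 0` at a point restricts to a function with a simple zero. -/
theorem eval_derivative_ne_zero (C : Chart E δ) {k m : ℕ} (hE : E.IsHomogeneous k) {f : Form}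
    (hf : f.IsHomogeneous m) {p : Point} {t s : ℂ} (hs : s ≠ 0) (hp : C.pt t = s • p.rep)
    (h : MeetTransversallyAt E f p) : (Polynomial.derivative (aeval C.φ f)).eval t ≠ 0 := by
  rw [C.dotProduct_vel hf hp]
  refine mul_ne_zero (pow_ne_zero _ hs) ?_
  refine dotProduct_ne_zero_of_linearIndependent (u := C.pt t) (C.indep t) h.2.2 ?_
    (C.grad_dotProduct_vel_eq_zero hE hs hp) ?_
  · rw [hp, dotProduct_smul, grad_dotProduct_rep hE h.1, smul_zero]
  · rw [hp, dotProduct_smul, grad_dotProduct_rep hf h.2.1, smul_zero]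

/-- Pairing a linear relation between the gradients with the velocity, which is tangent to `E = 0`,
kills the term of `E` and hence the coefficient of `f`. -/
theorem meetTransversallyAt (C : Chart E δ) {k m : ℕ} (hE : E.IsHomogeneous k) {f : Form}
    (hf : f.IsHomogeneous m) {p : Point} {t s : ℂ} (hs : s ≠ 0) (hp : C.pt t = s • p.rep)
    (hEp : Passes E p) (hfp : Passes f p) (hgrad : grad E p ≠ 0)
    (h : (Polynomial.derivative (aeval C.φ f)).eval t ≠ 0) : MeetTransversallyAt E f p := by
  refine ⟨hEp, hfp, ?_⟩
  rw [C.dotProduct_vel hf hp] at h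
  rw [LinearIndependent.pair_iff]
  intro a b hab
  have hb : b = 0 := by
    have := congrArg (· ⬝ᵥ C.vel t) hab
    simp only [add_dotProduct, smul_dotProduct, zero_dotProduct,
      C.grad_dotProduct_vel_eq_zero hE hs hp, smul_eq_mul, mul_zero, zero_add, mul_eq_zero] at this
    exact this.resolve_right (right_ne_zero_of_mul h)
  subst hb
  rw [zero_smul, add_zero, smul_eq_zero] at hab
  exact ⟨hab.resolve_right hgrad, rfl⟩

end Chart

/-! ### Lines and irreducible conics, and their charts -/

theorem gradAt_eq_of_isHomogeneous_one {f : Form} (hf : f.IsHomogeneous 1) (x y : Fin 3 → ℂ) :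
    gradAt f x = gradAt f y := by
  funext i
  have h : (pderiv i f).IsHomogeneous 0 := hf.pderiv
  rw [← totalDegree_zero_iff_isHomogeneous, totalDegree_eq_zero_iff_eq_C] at h
  rw [gradAt, gradAt, h, eval_C, eval_C]

theorem eval_eq_dotProduct {f : Form} (hf : f.IsHomogeneous 1) (x y : Fin 3 → ℂ) :
    eval x f = gradAt f y ⬝ᵥ x := by
  rw [gradAt_eq_of_isHomogeneous_one hf y x, euler_dotProduct hf, Nat.cast_one, one_mul]

theorem gradAt_ne_zero_of_isHomogeneous_one {f : Form} (hf : f.IsHomogeneous 1) (hf0 : f ≠ 0)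
    (x : Fin 3 → ℂ) : gradAt f x ≠ 0 := by
  intro h
  refine hf0 (MvPolynomial.funext fun y => ?_)
  rw [eval_eq_dotProduct hf y x, h, zero_dotProduct, map_zero]

theorem isUnit_of_totalDegree_eq_zero {a : Form} (ha : a ≠ 0) (h : a.totalDegree = 0) :
    IsUnit a := by
  rw [totalDegree_eq_zero_iff_eq_C] at h
  rw [h]
  refine (IsUnit.mk0 _ fun hc => ha ?_).map C
  rw [h, hc, C_0]

/-- A nonzero linear form is prime. -/
theorem prime_of_isHomogeneous_one {f : Form} (hf : f.IsHomogeneous 1) (hf0 : f ≠ 0) :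
    Prime f := by
  rw [← irreducible_iff_prime, irreducible_iff]
  have hdeg := hf.totalDegree hf0
  refine ⟨fun hu => ?_, fun a b hab => ?_⟩
  · obtain ⟨g, hg⟩ := hu.exists_right_inv
    have := congrArg totalDegree hg
    rw [totalDegree_mul_of_isDomain hf0 (by rintro rfl; simp at hg), totalDegree_one, hdeg] at this
    omega
  · have ha : a ≠ 0 := by rintro rfl; simp at hab; exact hf0 hab
    have hb : b ≠ 0 := by rintro rfl; simp at hab; exact hf0 hab
    rw [hab, totalDegree_mul_of_isDomain ha hb] at hdeg
    rcases Nat.eq_zero_or_pos a.totalDegree with h | h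
    · exact Or.inl (isUnit_of_totalDegree_eq_zero ha h)
    · exact Or.inr (isUnit_of_totalDegree_eq_zero hb (by omega))

/-- The linear form with given coefficients. -/
noncomputable def linForm (a : Fin 3 → ℂ) : Form := ∑ i, C (a i) * X i

theorem linForm_isHomogeneous (a : Fin 3 → ℂ) : (linForm a).IsHomogeneous 1 :=
  IsHomogeneous.sum _ _ _ fun _ _ => isHomogeneous_C_mul_X _ _

theorem eval_linForm (a x : Fin 3 → ℂ) : eval x (linForm a) = a ⬝ᵥ x := by
  simp [linForm, dotProduct]

theorem linForm_ne_zero {a : Fin 3 → ℂ} (ha : a ≠ 0) : linForm a ≠ 0 := by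
  intro h
  refine ha (funext fun i => ?_)
  have := eval_linForm a (Pi.single i 1)
  rw [h, map_zero] at this
  simpa using this.symm

/-- An irreducible conic does not divide a nonzero linear form, nor conversely. -/
theorem not_dvd_of_isHomogeneous_one {E m : Form} (hE : E.IsHomogeneous 2) (hm : m.IsHomogeneous 1)
    (hm0 : m ≠ 0) : ¬ E ∣ m := by
  rintro ⟨g, rfl⟩
  have hE0 := left_ne_zero_of_mul hm0
  have := hm.totalDegree hm0
  rw [totalDegree_mul_of_isDomain hE0 (right_ne_zero_of_mul hm0), hE.totalDegree hE0] at this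
  omega

theorem not_dvd_conic {E m : Form} (hE : E.IsHomogeneous 2) (hp : Prime E)
    (hm : m.IsHomogeneous 1) (hm0 : m ≠ 0) : ¬ m ∣ E := fun h =>
  not_dvd_of_isHomogeneous_one hE hm hm0
    ((prime_of_isHomogeneous_one hm hm0).dvd_prime_iff_associated hp |>.1 h).symm.dvd

theorem exists_orthogonal_linearIndependent (a : Fin 3 → ℂ) {q : Fin 3 → ℂ} (hq : q ≠ 0) :
    ∃ b, a ⬝ᵥ b = 0 ∧ LinearIndependent ℂ ![q, b] := by
  by_contra! hc
  obtain ⟨j, hj⟩ := Function.ne_iff.1 hq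
  rw [Pi.zero_apply] at hj
  have key : ∀ b, a ⬝ᵥ b = 0 → ∃ c : ℂ, b = c • q := by
    intro b hb
    have h := hc b hb
    rw [LinearIndependent.pair_iff' hq] at h
    push Not at h
    obtain ⟨c, hc⟩ := h
    exact ⟨c, hc.symm⟩
  let f : (Fin 3 → ℂ) →ₗ[ℂ] ℂ := dotProductBilin ℂ ℂ a
  have hle : LinearMap.ker f ≤ Submodule.span ℂ {q} := by
    intro b hb
    obtain ⟨c, rfl⟩ := key b hb
    exact Submodule.smul_mem _ _ (Submodule.mem_span_singleton_self q)
  have h1 := Submodule.finrank_mono hle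
  rw [finrank_span_singleton hq] at h1
  have h2 := f.finrank_range_add_finrank_ker
  have h3 : Module.finrank ℂ (LinearMap.range f) ≤ 1 :=
    (Submodule.finrank_le _).trans (Module.finrank_self ℂ).le
  simp at h2
  omega

/-- A line, with any of its points at infinity, has a chart. -/
theorem exists_chart_line {E : Form} (hE : E.IsHomogeneous 1) (hE0 : E ≠ 0) {q : Fin 3 → ℂ}
    (hq : q ≠ 0) (hEq : eval q E = 0) : ∃ C : Chart E 1, C.inf = q := by
  have hev : ∀ x, eval x E = gradAt E q ⬝ᵥ x := fun x => eval_eq_dotProduct hE x q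
  set g := gradAt E q with hg
  have hg0 : g ≠ 0 := gradAt_ne_zero_of_isHomogeneous_one hE hE0 q
  obtain ⟨w, hw, hind⟩ := exists_orthogonal_linearIndependent g hq
  have hgq : g ⬝ᵥ q = 0 := by rw [← hev, hEq]
  have hind' := LinearIndependent.pair_iff.1 hind
  let φ : Fin 3 → Polynomial ℂ := fun i => Polynomial.C (q i) * Polynomial.X + Polynomial.C (w i)
  have hpt : ∀ t, (fun i => (φ i).eval t) = t • q + w := by
    intro t; funext i
    simp only [φ, Polynomial.eval_add, Polynomial.eval_mul, Polynomial.eval_C, Polynomial.eval_X,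
      Pi.add_apply, Pi.smul_apply, smul_eq_mul]
    ring
  have hvel : ∀ t, (fun i => (Polynomial.derivative (φ i)).eval t) = q := by
    intro t; funext i
    simp only [φ, Polynomial.derivative_add, Polynomial.derivative_C_mul, Polynomial.derivative_X,
      Polynomial.derivative_C, Polynomial.eval_C, mul_one, add_zero]
  have hinf : (fun i => (φ i).coeff 1) = q := by
    funext i
    simp only [φ, Polynomial.coeff_add, Polynomial.coeff_C_mul, Polynomial.coeff_X_one, mul_one,
      Polynomial.coeff_C_of_ne_zero one_ne_zero, add_zero]
  refine ⟨⟨φ, fun i => ?_, ?_, fun t => ?_, fun t t' s h => ?_, fun x hx => ?_⟩, hinf⟩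
  · exact Polynomial.natDegree_linear_le
  · refine Polynomial.funext fun t => ?_
    rw [eval_aeval, hpt, hev, dotProduct_add, dotProduct_smul, hgq, hw]
    simp
  · rw [hpt, hvel, LinearIndependent.pair_iff]
    intro a b hab
    obtain ⟨h1, h2⟩ := hind' (a * t + b) a (by rw [← hab]; module)
    subst h2
    exact ⟨rfl, by simpa using h1⟩
  · rw [hpt, hpt] at h
    obtain ⟨h1, h2⟩ := hind' (t - s * t') (1 - s) (by
      have : (t - s * t') • q + (1 - s) • w = (t • q + w) - s • (t' • q + w) := by module
      rw [this, h, sub_self])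
    have hs : s = 1 := by linear_combination -h2
    subst hs
    linear_combination h1
  · have hx' : x ⬝ᵥ g = 0 := by rw [dotProduct_comm, ← hev, hx]
    obtain ⟨r, s, rfl⟩ := exists_eq_add_smul_of_dotProduct_eq_zero hg0 hind
      (by rw [dotProduct_comm, hgq]) (by rw [dotProduct_comm, hw]) hx'
    by_cases hs : s = 0
    · exact ⟨r, Or.inl (by rw [hinf, hs, zero_smul, add_zero])⟩
    · refine ⟨s, Or.inr ⟨r / s, ?_⟩⟩
      rw [hpt, smul_add, smul_smul, mul_div_cancel₀ _ hs]

/-- The polar form of a quadratic form. -/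
noncomputable def polar (E : Form) (x y : Fin 3 → ℂ) : ℂ := gradAt E x ⬝ᵥ y

/-- By Euler, twice a quadratic form is its polar form on the diagonal, and the polar form is
bilinear and symmetric since partial derivatives commute. -/
theorem eval_add_smul {E : Form} (hE : E.IsHomogeneous 2) (a b : ℂ) (x y : Fin 3 → ℂ) :
    eval (a • x + b • y) E = a ^ 2 * eval x E + a * b * polar E x y + b ^ 2 * eval y E := by
  have hlin : ∀ i z, gradAt E z i = ∑ j, eval 0 (pderiv j (pderiv i E)) * z j := fun i z =>
    eval_eq_dotProduct (hE.pderiv (i := i)) z 0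
  have hsymm : ∀ i j : Fin 3, pderiv j (pderiv i E) = pderiv i (pderiv j E) := by
    intro i j
    have h : ⁅(pderiv i : Derivation ℂ Form Form),
        (pderiv j : Derivation ℂ Form Form)⁆ = 0 := by
      refine MvPolynomial.derivation_ext fun l => ?_
      rw [Derivation.commutator_apply, pderiv_X, pderiv_X]
      simp only [Pi.single_apply, apply_ite, Derivation.map_one_eq_zero, map_zero, ite_self,
        sub_self, Derivation.coe_zero, Pi.zero_apply]
    have := congrArg (fun D => D E) h
    simp only [Derivation.commutator_apply, Derivation.coe_zero, Pi.zero_apply] at this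
    exact (sub_eq_zero.1 this).symm
  have hH : ∀ z w, polar E z w = ∑ i, ∑ j, eval 0 (pderiv j (pderiv i E)) * z j * w i := by
    intro z w
    simp only [polar, dotProduct, hlin, Finset.sum_mul]
  have h2 : ∀ z, 2 * eval z E = polar E z z := fun z => by
    rw [polar, euler_dotProduct hE]; norm_num
  have e01 : pderiv 1 (pderiv 0 E) = pderiv 0 (pderiv 1 E) := hsymm 0 1
  have e02 : pderiv 2 (pderiv 0 E) = pderiv 0 (pderiv 2 E) := hsymm 0 2
  have e12 : pderiv 2 (pderiv 1 E) = pderiv 1 (pderiv 2 E) := hsymm 1 2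
  refine mul_left_cancel₀ (two_ne_zero (α := ℂ)) ?_
  have : 2 * (a ^ 2 * eval x E + a * b * polar E x y + b ^ 2 * eval y E) =
    a ^ 2 * (2 * eval x E) + 2 * (a * b * polar E x y) + b ^ 2 * (2 * eval y E) := by ring
  rw [this, h2, h2, h2]
  simp only [hH, Fin.sum_univ_three, Pi.add_apply, Pi.smul_apply, smul_eq_mul, e01, e02, e12]
  ring

/-- An irreducible conic contains no line. -/
theorem not_forall_eval_eq_zero {E : Form} (hE : E.IsHomogeneous 2) (hp : Prime E)
    {u v : Fin 3 → ℂ} (huv : LinearIndependent ℂ ![u, v])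
    (h : ∀ a b : ℂ, eval (a • u + b • v) E = 0) : False := by
  have hc : crossProduct u v ≠ 0 := crossProduct_ne_zero_iff_linearIndependent.2 huv
  refine not_dvd_conic hE hp (linForm_isHomogeneous _) (linForm_ne_zero hc)
    (dvd_of_forall_eval_eq_zero (prime_of_isHomogeneous_one (linForm_isHomogeneous _)
      (linForm_ne_zero hc)) fun x hx => ?_)
  rw [eval_linForm, dotProduct_comm] at hx
  obtain ⟨r, s, rfl⟩ := exists_eq_add_smul_of_dotProduct_eq_zero hc huv
    (dot_self_cross u v) (dot_cross_self u v) hx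
  exact h r s

/-- An irreducible conic is smooth. -/
theorem gradAt_ne_zero_of_prime {E : Form} (hE : E.IsHomogeneous 2) (hp : Prime E)
    {q : Fin 3 → ℂ} (hq : q ≠ 0) (hEq : eval q E = 0) : gradAt E q ≠ 0 := by
  intro hg
  obtain ⟨b, -, hb⟩ := exists_orthogonal_linearIndependent 0 hq
  have hc : crossProduct q b ≠ 0 := crossProduct_ne_zero_iff_linearIndependent.2 hb
  have hnd := not_dvd_of_isHomogeneous_one hE (linForm_isHomogeneous _) (linForm_ne_zero hc)
  -- The conic has a point off a chosen line through `q`. If `q` were singular, the conic would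
  -- contain the line joining `q` to that point.
  obtain ⟨w, hw, hw'⟩ : ∃ w, eval w E = 0 ∧ eval w (linForm (crossProduct q b)) ≠ 0 := by
    by_contra! h
    exact hnd (dvd_of_forall_eval_eq_zero hp h)
  rw [eval_linForm] at hw'
  have hind : LinearIndependent ℂ ![q, w] := by
    rw [LinearIndependent.pair_iff' hq]
    rintro c rfl
    rw [dotProduct_smul, dotProduct_comm, dot_self_cross, smul_zero] at hw'
    exact hw' rfl
  refine not_forall_eval_eq_zero hE hp hind fun a b => ?_
  rw [eval_add_smul hE, hEq, hw, polar, hg, zero_dotProduct]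
  ring

/-- An irreducible conic, with any of its points at infinity, has a chart. -/
theorem exists_chart_conic {E : Form} (hE : E.IsHomogeneous 2) (hp : Prime E) {q : Fin 3 → ℂ}
    (hq : q ≠ 0) (hEq : eval q E = 0) : ∃ (C : Chart E 2) (s : ℂ), s ≠ 0 ∧ C.inf = s • q := by
  set g := gradAt E q with hg
  have hg0 : g ≠ 0 := gradAt_ne_zero_of_prime hE hp hq hEq
  have hgq : g ⬝ᵥ q = 0 := by rw [hg, euler_dotProduct hE, hEq, mul_zero]
  obtain ⟨b, hgb, hind⟩ := exists_orthogonal_linearIndependent g hq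
  have hind' := LinearIndependent.pair_iff.1 hind
  -- Otherwise the conic would contain its tangent line at `q`, which is spanned by `q` and `b`.
  have hb : eval b E ≠ 0 := by
    intro hb
    refine not_forall_eval_eq_zero hE hp hind fun r s => ?_
    rw [eval_add_smul hE, hEq, hb, polar, ← hg, hgb]
    ring
  obtain ⟨a, ha⟩ : ∃ a, g ⬝ᵥ a ≠ 0 := by
    by_contra! h
    exact hg0 (dotProduct_eq_zero_iff.1 h)
  set k := g ⬝ᵥ a with hk
  -- Projection from `q`: `φ(t)` is the second intersection of the conic with the line joining `q`
  -- to `a + t b`. The value at infinity is a multiple of `q`, corresponding to the tangent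
  -- direction `b`.
  let N : Polynomial ℂ := Polynomial.C (eval b E) * Polynomial.X ^ 2 +
    Polynomial.C (polar E a b) * Polynomial.X + Polynomial.C (eval a E)
  let φ : Fin 3 → Polynomial ℂ := fun i => Polynomial.C (q i) * N -
    Polynomial.C k * (Polynomial.C (b i) * Polynomial.X + Polynomial.C (a i))
  have hN : ∀ t : ℂ, N.eval t = eval (a + t • b) E := by
    intro t
    have := eval_add_smul hE 1 t a b
    rw [one_smul] at this
    rw [this]
    simp [N]
    ring
  have hpt : ∀ t, (fun i => (φ i).eval t) = N.eval t • q - k • (a + t • b) := by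
    intro t; funext i
    simp only [φ, Polynomial.eval_sub, Polynomial.eval_mul, Polynomial.eval_C, Polynomial.eval_add,
      Polynomial.eval_X, Pi.sub_apply, Pi.smul_apply, Pi.add_apply, smul_eq_mul]
    ring
  have hvel : ∀ t, (fun i => (Polynomial.derivative (φ i)).eval t) =
      (Polynomial.derivative N).eval t • q - k • b := by
    intro t; funext i
    simp only [φ, Polynomial.derivative_sub, Polynomial.derivative_C_mul, Polynomial.derivative_add,
      Polynomial.derivative_C, Polynomial.derivative_X, Polynomial.eval_sub, Polynomial.eval_mul,
      Polynomial.eval_C, mul_one, add_zero, Pi.sub_apply, Pi.smul_apply,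
      smul_eq_mul]
    ring
  have hinf : (fun i => (φ i).coeff 2) = eval b E • q := by
    funext i
    simp only [φ, N, Polynomial.coeff_sub, Polynomial.coeff_add, Polynomial.coeff_C_mul,
      Polynomial.coeff_X_pow_self, Polynomial.coeff_X_of_ne_one (show 2 ≠ 1 by norm_num), mul_zero,
      Polynomial.coeff_C_of_ne_zero two_ne_zero, mul_one, add_zero, sub_zero, Pi.smul_apply,
      smul_eq_mul]
    ring
  refine ⟨⟨φ, fun i => ?_, ?_, fun t => ?_, fun t t' s h => ?_, fun x hx => ?_⟩, _, hb, hinf⟩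
  · refine (Polynomial.natDegree_sub_le _ _).trans (max_le ?_ ?_)
    · exact (Polynomial.natDegree_C_mul_le _ _).trans Polynomial.natDegree_quadratic_le
    · exact (Polynomial.natDegree_C_mul_le _ _).trans
        (Polynomial.natDegree_linear_le.trans one_le_two)
  · refine Polynomial.funext fun t => ?_
    rw [eval_aeval, hpt, sub_eq_add_neg, ← neg_smul, eval_add_smul hE, hEq, polar, ← hg,
      dotProduct_add, dotProduct_smul, hgb, ← hk, ← hN]
    simp
    ring
  · rw [hpt, hvel, LinearIndependent.pair_iff]
    intro r s hrs
    have h1 := congrArg (g ⬝ᵥ ·) hrs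
    simp only [dotProduct_add, dotProduct_smul, dotProduct_sub, hgq, hgb, ← hk, dotProduct_zero,
      smul_eq_mul] at h1
    have hr : r = 0 := by
      by_contra hr
      exact mul_ne_zero hr (neg_ne_zero.2 (mul_ne_zero ha ha)) (by linear_combination h1)
    subst hr
    obtain ⟨-, h2⟩ := hind' (s * (Polynomial.derivative N).eval t) (-(s * k)) (by
      rw [← hrs]; module)
    exact ⟨rfl, (mul_eq_zero.1 (neg_eq_zero.1 h2)).resolve_right ha⟩
  · rw [hpt, hpt] at h
    have h1 := congrArg (g ⬝ᵥ ·) h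
    simp only [dotProduct_add, dotProduct_smul, dotProduct_sub, hgq, hgb, ← hk,
      smul_eq_mul] at h1
    -- Since `g` annihilates `q` and `b`, its pairing with `φ(t)` is `-k²` for every `t`.
    have hs : s = 1 := by
      refine mul_right_cancel₀ (mul_ne_zero ha ha) ?_
      linear_combination h1
    subst hs
    obtain ⟨-, h2⟩ := hind' (N.eval t - N.eval t') (-(k * (t - t'))) (by
      rw [← sub_eq_zero] at h
      rw [← h]; module)
    exact sub_eq_zero.1 ((mul_eq_zero.1 (neg_eq_zero.1 h2)).resolve_left ha)
  · obtain ⟨r, s, hrs⟩ := exists_eq_add_smul_of_dotProduct_eq_zero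
      (ξ := x - ((g ⬝ᵥ x) / k) • a) hg0 hind
      (by rw [dotProduct_comm, hgq]) (by rw [dotProduct_comm, hgb])
      (by rw [dotProduct_comm, dotProduct_sub, dotProduct_smul, ← hk, smul_eq_mul,
        div_mul_cancel₀ _ ha, sub_self])
    set c := (g ⬝ᵥ x) / k with hc
    have hx' : x = r • q + s • b + c • a := sub_eq_iff_eq_add.1 hrs
    -- The case `c = 0` is a point of the tangent line, which meets the conic only in `q`; otherwise
    -- the parameter is `s / c`.
    by_cases hc0 : c = 0
    · rw [hc0, zero_smul, add_zero] at hx'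
      rw [hx', eval_add_smul hE, hEq, polar, ← hg, hgb] at hx
      have hs : s = 0 := by
        by_contra hs
        exact mul_ne_zero (pow_ne_zero 2 hs) hb (by linear_combination hx)
      refine ⟨r / eval b E, Or.inl ?_⟩
      rw [hinf, smul_smul, div_mul_cancel₀ _ hb, hx', hs, zero_smul, add_zero]
    · have hx'' : x = r • q + c • (a + (s / c) • b) := by
        rw [hx', smul_add, smul_smul, mul_div_cancel₀ _ hc0]
        abel
      rw [hx'', eval_add_smul hE, hEq, polar, ← hg, dotProduct_add, dotProduct_smul, hgb, ← hk,
        ← hN, smul_zero, add_zero] at hx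
      have hr : r = -(c / k) * N.eval (s / c) := by
        refine mul_left_cancel₀ (mul_ne_zero hc0 ha) ?_
        have : c * k * (-(c / k) * N.eval (s / c)) = -(c * (c * (k / k)) * N.eval (s / c)) := by ring
        rw [this, div_self ha]
        linear_combination hx
      refine ⟨-(c / k), Or.inr ⟨s / c, ?_⟩⟩
      rw [hpt, hx'', smul_sub, smul_smul, ← hr, smul_smul, neg_mul, div_mul_cancel₀ _ ha, neg_smul,
        sub_neg_eq_add]

/-- Since `E` does not divide `f`, some point of `E = 0` lies off `f = 0`; it is sent to infinity.
-/
theorem exists_chart {E f : Form} {δ m : ℕ} (hp : Prime E) (hδ : δ = 1 ∨ δ = 2)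
    (hE : E.IsHomogeneous δ) (hf : f.IsHomogeneous m) (hm : m ≠ 0) (hEf : ¬ E ∣ f) :
    ∃ C : Chart E δ, eval C.inf f ≠ 0 := by
  obtain ⟨q, hq, hqf⟩ : ∃ q, eval q E = 0 ∧ eval q f ≠ 0 := by
    by_contra! h
    exact hEf (dvd_of_forall_eval_eq_zero hp h)
  have hq0 : q ≠ 0 := by
    rintro rfl
    rw [← zero_smul ℂ (0 : Fin 3 → ℂ), eval_smul_of_isHomogeneous hf, zero_pow hm, zero_mul] at hqf
    exact hqf rfl
  rcases hδ with rfl | rfl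
  · obtain ⟨C, hC⟩ := exists_chart_line hE hp.ne_zero hq0 hq
    exact ⟨C, hC ▸ hqf⟩
  · obtain ⟨C, s, hs, hC⟩ := exists_chart_conic hE hp hq0 hq
    refine ⟨C, ?_⟩
    rw [hC, eval_smul_of_isHomogeneous hf]
    exact mul_ne_zero (pow_ne_zero _ hs) hqf

/-! ### An adjoint restricted to one edge -/

/-- `E = 0` is an irreducible component of degree `δ ≤ 2` of the curve `E h = 0`, which it meets
transversally at the vertices `w₁` and `w₂`, and `α` is an adjoint of this curve along `E = 0`
outside the vertices. -/
structure AdjointEdge (E h α : Form) (δ m e : ℕ) (w₁ w₂ : Point) : Prop where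
  prime : Prime E
  degree : δ = 1 ∨ δ = 2
  homE : E.IsHomogeneous δ
  homh : h.IsHomogeneous m
  homα : α.IsHomogeneous e
  add_three : e + 3 = δ + m
  not_dvd : ¬ E ∣ h
  ne : w₁ ≠ w₂
  left : MeetTransversallyAt E h w₁
  right : MeetTransversallyAt E h w₂
  conductor : ∀ p, Passes E p → Passes h p → p ≠ w₁ → p ≠ w₂ → InConductorAt (E * h) α p

namespace AdjointEdge

variable {E h α : Form} {δ m e : ℕ} {w₁ w₂ : Point}

theorem symm (H : AdjointEdge E h α δ m e w₁ w₂) : AdjointEdge E h α δ m e w₂ w₁ :=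
  { H with
    ne := H.ne.symm
    left := H.right
    right := H.left
    conductor := fun p h1 h2 h3 h4 => H.conductor p h1 h2 h4 h3 }

theorem m_ne_zero (H : AdjointEdge E h α δ m e w₁ w₂) : m ≠ 0 := by
  have h1 := H.degree
  have h2 := H.add_three
  omega

/-- The restriction of an adjoint to an edge is, up to a constant factor, the restriction of the
complementary curve, divided by the equations of the two vertices. -/
theorem exists_relation (H : AdjointEdge E h α δ m e w₁ w₂) (C : Chart E δ)
    (hinf : eval C.inf h ≠ 0) {t₁ t₂ s₁ s₂ : ℂ} (hs₁ : s₁ ≠ 0) (hs₂ : s₂ ≠ 0)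
    (ht₁ : C.pt t₁ = s₁ • w₁.rep) (ht₂ : C.pt t₂ = s₂ • w₂.rep) :
    ∃ κ : ℂ, aeval C.φ α * ((Polynomial.X - Polynomial.C t₁) * (Polynomial.X - Polynomial.C t₂)) =
      Polynomial.C κ * aeval C.φ h := by
  have hder₁ := C.eval_derivative_ne_zero H.homE H.homh hs₁ ht₁ H.left
  have hder₂ := C.eval_derivative_ne_zero H.homE H.homh hs₂ ht₂ H.right
  obtain ⟨hdeg, hcoeff⟩ := C.natDegree_comp_le_and_coeff H.homh
  have hdega := (C.natDegree_comp_le_and_coeff H.homα).1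
  -- Every finite parameter is that of a point of `E = 0`; away from the vertices the conductor
  -- condition applies there.
  have hord : ∀ t, t ≠ t₁ → t ≠ t₂ → (aeval C.φ h).eval t = 0 → ∀ N,
      (Polynomial.X - Polynomial.C t) ^ N ∣ aeval C.φ h →
      (Polynomial.X - Polynomial.C t) ^ N ∣ aeval C.φ α := by
    intro t h1 h2 h0 N hN
    have hpt0 : C.pt t ≠ 0 := (C.indep t).ne_zero 0
    obtain ⟨a, ha⟩ := Projectivization.exists_smul_eq_mk_rep ℂ (C.pt t) hpt0
    set p : Point := Projectivization.mk ℂ (C.pt t) hpt0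
    have hpa : C.pt t = (a⁻¹ : ℂ) • p.rep := by
      rw [← ha, Units.smul_def, smul_smul, inv_mul_cancel₀ a.ne_zero, one_smul]
    have ha' : (a⁻¹ : ℂ) ≠ 0 := inv_ne_zero a.ne_zero
    have hEp : Passes E p := (C.eval_comp_eq_zero_iff H.homE ha' hpa).1 (by
      rw [C.comp_eq_zero, Polynomial.eval_zero])
    have hhp : Passes h p := (C.eval_comp_eq_zero_iff H.homh ha' hpa).1 h0
    have hc := H.conductor p hEp hhp
      (fun hp => h1 (C.param_eq hs₁ (hp ▸ hpa) ht₁)) (fun hp => h2 (C.param_eq hs₂ (hp ▸ hpa) ht₂))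
    have hrel : IsRelPrime E h := H.prime.irreducible.isRelPrime_iff_not_dvd.2 H.not_dvd
    have hh0 : h ≠ 0 := by rintro rfl; exact H.not_dvd (dvd_zero _)
    exact pow_dvd_aeval_of_mem_span H.homα H.homE H.homh (hc.mem_span hrel hh0) C.comp_eq_zero
      ha' hpa hN
  set A := aeval C.φ α
  set B := aeval C.φ h
  set W := (Polynomial.X - Polynomial.C t₁) * (Polynomial.X - Polynomial.C t₂) with hW
  have hW0 : W ≠ 0 := mul_ne_zero (Polynomial.X_sub_C_ne_zero _) (Polynomial.X_sub_C_ne_zero _)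
  have hWdeg : W.natDegree = 2 := by
    rw [hW, Polynomial.natDegree_mul (Polynomial.X_sub_C_ne_zero _) (Polynomial.X_sub_C_ne_zero _),
      Polynomial.natDegree_X_sub_C, Polynomial.natDegree_X_sub_C]
  by_cases hA0 : A = 0
  · exact ⟨0, by rw [hA0, zero_mul, Polynomial.C_0, zero_mul]⟩
  have hB0 : B ≠ 0 := by
    intro h0
    rw [h0, Polynomial.coeff_zero] at hcoeff
    exact hinf hcoeff.symm
  have hBdeg : B.natDegree = δ * m :=
    le_antisymm hdeg (Polynomial.le_natDegree_of_ne_zero (hcoeff ▸ hinf))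
  have hsimple : ∀ t, (Polynomial.derivative B).eval t ≠ 0 → B.rootMultiplicity t ≤ 1 := by
    intro t ht
    by_contra! hlt
    exact ht ((Polynomial.one_lt_rootMultiplicity_iff_isRoot hB0).1 hlt).2
  -- Over `ℂ`, divisibility is a comparison of root multiplicities. The simple zeros of `B` at the
  -- vertices are absorbed by `W`, all others by `A`.
  have hdvd : B ∣ A * W := by
    rw [IsAlgClosed.dvd_iff_roots_le_roots hB0 (mul_ne_zero hA0 hW0), Multiset.le_iff_count]
    intro t
    rw [Polynomial.count_roots, Polynomial.count_roots,
      Polynomial.le_rootMultiplicity_iff (mul_ne_zero hA0 hW0)]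
    by_cases h1 : t = t₁
    · subst h1
      exact (pow_dvd_pow _ (hsimple t hder₁)).trans
        (by rw [pow_one]; exact (dvd_mul_right _ _).mul_left _)
    by_cases h2 : t = t₂
    · subst h2
      exact (pow_dvd_pow _ (hsimple t hder₂)).trans
        (by rw [pow_one]; exact (dvd_mul_left _ _).mul_left _)
    refine Dvd.dvd.mul_right ?_ _
    by_cases h0 : B.eval t = 0
    · exact hord t h1 h2 h0 _ (Polynomial.pow_rootMultiplicity_dvd _ _)
    · rw [Polynomial.rootMultiplicity_eq_zero h0, pow_zero]
      exact one_dvd _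
  obtain ⟨Q, hQ⟩ := hdvd
  have hQ0 : Q ≠ 0 := by
    rintro rfl
    rw [mul_zero] at hQ
    exact mul_ne_zero hA0 hW0 hQ
  -- Here `δ e + 2 = δ m`, because `e = δ + m - 3` and `δ² - 3δ + 2 = 0` for `δ = 1, 2`.
  have hQdeg : Q.natDegree = 0 := by
    have := congrArg Polynomial.natDegree hQ
    rw [Polynomial.natDegree_mul hA0 hW0, Polynomial.natDegree_mul hB0 hQ0, hWdeg, hBdeg] at this
    have h3 := H.add_three
    rcases H.degree with rfl | rfl <;> omega
  refine ⟨Q.coeff 0, ?_⟩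
  rw [hQ, ← Polynomial.eq_C_of_natDegree_eq_zero hQdeg, mul_comm]

theorem param_ne (H : AdjointEdge E h α δ m e w₁ w₂) (C : Chart E δ) {t₁ t₂ s₁ s₂ : ℂ}
    (hs₁ : s₁ ≠ 0) (ht₁ : C.pt t₁ = s₁ • w₁.rep) (ht₂ : C.pt t₂ = s₂ • w₂.rep) : t₁ ≠ t₂ := by
  rintro rfl
  exact H.ne (C.point_eq hs₁ ht₁ ht₂)

theorem passes_left_iff_of_relation (H : AdjointEdge E h α δ m e w₁ w₂) (C : Chart E δ)
    {t₁ t₂ s₁ s₂ κ : ℂ} (hs₁ : s₁ ≠ 0)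
    (ht₁ : C.pt t₁ = s₁ • w₁.rep) (ht₂ : C.pt t₂ = s₂ • w₂.rep)
    (hκ : aeval C.φ α * ((Polynomial.X - Polynomial.C t₁) * (Polynomial.X - Polynomial.C t₂)) =
      Polynomial.C κ * aeval C.φ h) : Passes α w₁ ↔ κ = 0 := by
  have hder := C.eval_derivative_ne_zero H.homE H.homh hs₁ ht₁ H.left
  have hne : t₁ - t₂ ≠ 0 := sub_ne_zero.2 (H.param_ne C hs₁ ht₁ ht₂)
  -- Both sides vanish at `t₁`; their derivatives give `α(t₁)(t₁ - t₂) = κ h'(t₁)`, where `h'(t₁) ≠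
  -- 0` by transversality.
  have h1 := congrArg (fun q => (Polynomial.derivative q).eval t₁) hκ
  simp only [Polynomial.derivative_mul, Polynomial.derivative_sub, Polynomial.derivative_X,
    Polynomial.derivative_C, Polynomial.eval_add, Polynomial.eval_mul, Polynomial.eval_sub,
    Polynomial.eval_X, Polynomial.eval_C, sub_self, zero_mul, mul_zero, sub_zero,
    Polynomial.eval_one, one_mul, zero_add, add_zero] at h1
  rw [← C.eval_comp_eq_zero_iff H.homα hs₁ ht₁]
  constructor
  · intro h0
    rw [h0, zero_mul] at h1
    exact (mul_eq_zero.1 h1.symm).resolve_right hder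
  · rintro rfl
    rw [zero_mul] at h1
    exact (mul_eq_zero.1 h1).resolve_right hne

theorem dvd_iff_of_relation (H : AdjointEdge E h α δ m e w₁ w₂) (C : Chart E δ)
    (hinf : eval C.inf h ≠ 0) {t₁ t₂ κ : ℂ}
    (hκ : aeval C.φ α * ((Polynomial.X - Polynomial.C t₁) * (Polynomial.X - Polynomial.C t₂)) =
      Polynomial.C κ * aeval C.φ h) : E ∣ α ↔ κ = 0 := by
  constructor
  · intro hd
    rw [C.comp_eq_zero_of_dvd hd, zero_mul, eq_comm, mul_eq_zero, Polynomial.C_eq_zero] at hκ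
    refine hκ.resolve_right fun h0 => hinf ?_
    rw [← (C.natDegree_comp_le_and_coeff H.homh).2, h0, Polynomial.coeff_zero]
  · rintro rfl
    rw [Polynomial.C_0, zero_mul] at hκ
    exact C.dvd_of_comp_eq_zero H.prime H.homα ((mul_eq_zero.1 hκ).resolve_right
      (mul_ne_zero (Polynomial.X_sub_C_ne_zero _) (Polynomial.X_sub_C_ne_zero _)))

theorem exists_chart_relation (H : AdjointEdge E h α δ m e w₁ w₂) :
    ∃ (C : Chart E δ) (t₁ t₂ s₁ s₂ κ : ℂ), eval C.inf h ≠ 0 ∧ s₁ ≠ 0 ∧ s₂ ≠ 0 ∧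
      C.pt t₁ = s₁ • w₁.rep ∧ C.pt t₂ = s₂ • w₂.rep ∧
      aeval C.φ α * ((Polynomial.X - Polynomial.C t₁) * (Polynomial.X - Polynomial.C t₂)) =
        Polynomial.C κ * aeval C.φ h := by
  obtain ⟨C, hinf⟩ := exists_chart H.prime H.degree H.homE H.homh H.m_ne_zero H.not_dvd
  obtain ⟨t₁, s₁, hs₁, ht₁⟩ := C.exists_param H.homh hinf H.left.1 H.left.2.1
  obtain ⟨t₂, s₂, hs₂, ht₂⟩ := C.exists_param H.homh hinf H.right.1 H.right.2.1
  obtain ⟨κ, hκ⟩ := H.exists_relation C hinf hs₁ hs₂ ht₁ ht₂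
  exact ⟨C, t₁, t₂, s₁, s₂, κ, hinf, hs₁, hs₂, ht₁, ht₂, hκ⟩

theorem passes_left_iff (H : AdjointEdge E h α δ m e w₁ w₂) : Passes α w₁ ↔ E ∣ α := by
  obtain ⟨C, t₁, t₂, s₁, s₂, κ, hinf, hs₁, hs₂, ht₁, ht₂, hκ⟩ := H.exists_chart_relation
  rw [H.passes_left_iff_of_relation C hs₁ ht₁ ht₂ hκ, H.dvd_iff_of_relation C hinf hκ]

theorem passes_right_iff (H : AdjointEdge E h α δ m e w₁ w₂) : Passes α w₂ ↔ E ∣ α :=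
  H.symm.passes_left_iff

/-- Comparison of the coefficients in degree `δ m = δ e + 2`: the product of the vertex factors is
monic. -/
theorem eval_inf_ne_zero (H : AdjointEdge E h α δ m e w₁ w₂) (C : Chart E δ)
    (hinf : eval C.inf h ≠ 0) {t₁ t₂ κ : ℂ} (hκ0 : κ ≠ 0)
    (hκ : aeval C.φ α * ((Polynomial.X - Polynomial.C t₁) * (Polynomial.X - Polynomial.C t₂)) =
      Polynomial.C κ * aeval C.φ h) : eval C.inf α ≠ 0 := by
  have hlin : ∀ t : ℂ, (Polynomial.X - Polynomial.C t).natDegree ≤ 1 := fun t =>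
    (Polynomial.natDegree_X_sub_C t).le
  have hα := C.natDegree_comp_le_and_coeff H.homα
  have h1 := congrArg (fun q => Polynomial.coeff q (δ * m)) hκ
  have hdm : δ * m = δ * e + (1 + 1) := by
    have h3 := H.add_three
    rcases H.degree with rfl | rfl <;> omega
  simp only [Polynomial.coeff_C_mul, (C.natDegree_comp_le_and_coeff H.homh).2] at h1
  rw [hdm, Polynomial.coeff_mul_add_eq_of_natDegree_le hα.1
    (Polynomial.natDegree_mul_le_of_le (hlin t₁) (hlin t₂)),
    Polynomial.coeff_mul_add_eq_of_natDegree_le (hlin t₁) (hlin t₂), hα.2] at h1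
  intro h0
  rw [h0, zero_mul] at h1
  exact mul_ne_zero hκ0 hinf h1.symm

/-- The relation turns a zero of `α` on the edge into one of `h`. If the zero of `h` is simple,
differentiating the relation shows that the zero of `α` is simple too. -/
theorem passes_of_passes (H : AdjointEdge E h α δ m e w₁ w₂) (hd : ¬ E ∣ α) {p : Point}
    (hE : Passes E p) (hp : Passes α p) :
    Passes h p ∧ (MeetTransversallyAt E h p → MeetTransversallyAt E α p) := by
  obtain ⟨C, t₁, t₂, s₁, s₂, κ, hinf, hs₁, hs₂, ht₁, ht₂, hκ⟩ := H.exists_chart_relation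
  have hκ0 : κ ≠ 0 := fun h0 => hd ((H.dvd_iff_of_relation C hinf hκ).2 h0)
  obtain ⟨t, s, hs, ht⟩ := C.exists_param H.homα (H.eval_inf_ne_zero C hinf hκ0 hκ) hE hp
  have hαt := (C.eval_comp_eq_zero_iff H.homα hs ht).2 hp
  have hht : (aeval C.φ h).eval t = 0 := by
    have h1 := congrArg (Polynomial.eval t) hκ
    rw [Polynomial.eval_mul, hαt, zero_mul, Polynomial.eval_mul, Polynomial.eval_C] at h1
    exact (mul_eq_zero.1 h1.symm).resolve_left hκ0
  refine ⟨(C.eval_comp_eq_zero_iff H.homh hs ht).1 hht, fun htr => ?_⟩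
  refine C.meetTransversallyAt H.homE H.homα hs ht hE hp (htr.2.2.ne_zero 0) fun h0 => ?_
  have h1 := congrArg (fun q => (Polynomial.derivative q).eval t) hκ
  rw [Polynomial.derivative_mul, Polynomial.derivative_C_mul, Polynomial.eval_add, Polynomial.eval_mul,
    h0, zero_mul, zero_add, Polynomial.eval_mul, hαt, zero_mul,
    Polynomial.eval_mul, Polynomial.eval_C] at h1
  exact mul_ne_zero hκ0 (C.eval_derivative_ne_zero H.homE H.homh hs ht htr) h1.symm

theorem finite_setOf_passes (H : AdjointEdge E h α δ m e w₁ w₂) (hd : ¬ E ∣ α) :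
    {p | Passes E p ∧ Passes α p}.Finite := by
  obtain ⟨C, t₁, t₂, s₁, s₂, κ, hinf, hs₁, hs₂, ht₁, ht₂, hκ⟩ := H.exists_chart_relation
  have hκ0 : κ ≠ 0 := fun h0 => hd ((H.dvd_iff_of_relation C hinf hκ).2 h0)
  have hpar : ∀ p : {p | Passes E p ∧ Passes α p}, ∃ t s : ℂ, s ≠ 0 ∧ C.pt t = s • p.1.rep :=
    fun p => C.exists_param H.homα (H.eval_inf_ne_zero C hinf hκ0 hκ) p.2.1 p.2.2
  choose t s hs ht using hpar
  have ht0 : ∀ p, t p ∈ (aeval C.φ α).rootSet ℂ := by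
    intro p
    rw [Polynomial.mem_rootSet]
    refine ⟨fun h0 => hd (C.dvd_of_comp_eq_zero H.prime H.homα h0), ?_⟩
    rw [Polynomial.coe_aeval_eq_eval]
    exact (C.eval_comp_eq_zero_iff H.homα (hs p) (ht p)).2 p.2.2
  have hinj : Function.Injective fun p => (⟨t p, ht0 p⟩ : (aeval C.φ α).rootSet ℂ) := by
    intro p q hpq
    have htpq : t p = t q := congrArg Subtype.val hpq
    exact Subtype.ext (C.point_eq (hs p) (ht p) (htpq ▸ ht q))
  have : Finite {p | Passes E p ∧ Passes α p} := Finite.of_injective _ hinj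
  exact Set.toFinite _

/-- Two adjoints along the same edge, of different curves, are proportional up to the equations of
these curves. -/
theorem exists_dvd_sub {h' α' l c : Form} {m' e' d : ℕ} (H : AdjointEdge E h α δ m e w₁ w₂)
    (H' : AdjointEdge E h' α' δ m' e' w₁ w₂) (hd : ¬ E ∣ α) (hd' : ¬ E ∣ α')
    (hlc : h * l = h' * c) (hl : (α * l).IsHomogeneous d) (hc : (α' * c).IsHomogeneous d) :
    ∃ r : ℂ, r ≠ 0 ∧ E ∣ α * l - C r * (α' * c) := by
  -- A single chart must serve both relations, so its point at infinity avoids `h` and `h'`.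
  obtain ⟨X, hX⟩ := exists_chart H.prime H.degree H.homE (H.homh.mul H'.homh)
    (by have := H.m_ne_zero; omega) (fun h0 => (H.prime.dvd_or_dvd h0).elim H.not_dvd H'.not_dvd)
  rw [map_mul] at hX
  have hinf := left_ne_zero_of_mul hX
  have hinf' := right_ne_zero_of_mul hX
  obtain ⟨t₁, s₁, hs₁, ht₁⟩ := X.exists_param H.homh hinf H.left.1 H.left.2.1
  obtain ⟨t₂, s₂, hs₂, ht₂⟩ := X.exists_param H.homh hinf H.right.1 H.right.2.1
  obtain ⟨κ, hκ⟩ := H.exists_relation X hinf hs₁ hs₂ ht₁ ht₂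
  obtain ⟨κ', hκ'⟩ := H'.exists_relation X hinf' hs₁ hs₂ ht₁ ht₂
  have hκ0 : κ ≠ 0 := fun h0 => hd ((H.dvd_iff_of_relation X hinf hκ).2 h0)
  have hκ0' : κ' ≠ 0 := fun h0 => hd' ((H'.dvd_iff_of_relation X hinf' hκ').2 h0)
  refine ⟨κ / κ', div_ne_zero hκ0 hκ0', X.dvd_of_comp_eq_zero H.prime (hl.sub (hc.C_mul _)) ?_⟩
  refine mul_right_cancel₀ (mul_ne_zero (Polynomial.X_sub_C_ne_zero t₁)
    (Polynomial.X_sub_C_ne_zero t₂)) ?_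
  have hlc' := congrArg (aeval X.φ) hlc
  rw [map_mul, map_mul] at hlc'
  have hC : (Polynomial.C (κ / κ') * Polynomial.C κ' : Polynomial ℂ) = Polynomial.C κ := by
    rw [← Polynomial.C_mul, div_mul_cancel₀ _ hκ0']
  rw [map_sub, map_mul, map_mul, map_mul, aeval_C, Polynomial.algebraMap_eq, zero_mul]
  linear_combination aeval X.φ l * hκ - Polynomial.C (κ / κ') * aeval X.φ c * hκ' +
    Polynomial.C κ * hlc' - aeval X.φ c * aeval X.φ h' * hC

end AdjointEdge

/-! ### Transversality of products, and line pairs -/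

theorem MeetTransversallyAt.symm {f g : Form} {p : Point} (h : MeetTransversallyAt f g p) :
    MeetTransversallyAt g f p :=
  ⟨h.2.1, h.1, LinearIndependent.pair_symm_iff.1 h.2.2⟩

theorem meetTransversallyAt_mul_right_iff {f g u : Form} {p : Point} (hu : ¬ Passes u p) :
    MeetTransversallyAt f (g * u) p ↔ MeetTransversallyAt f g p := by
  unfold MeetTransversallyAt
  rw [passes_mul_iff, or_iff_left hu]
  refine and_congr_right fun _ => and_congr_right fun hg => ?_
  have hgrad : grad (g * u) p = eval p.rep u • grad g p := by
    rw [grad_eq_gradAt, gradAt_mul, show eval p.rep g = 0 from hg, zero_smul, zero_add]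
    rfl
  rw [hgrad, LinearIndependent.pair_iff, LinearIndependent.pair_iff]
  have hu' : eval p.rep u ≠ 0 := hu
  constructor
  · intro h s t hst
    obtain ⟨h1, h2⟩ := h s (t * (eval p.rep u)⁻¹) (by
      rw [smul_smul, mul_assoc, inv_mul_cancel₀ hu', mul_one, hst])
    exact ⟨h1, (mul_eq_zero.1 h2).resolve_right (inv_ne_zero hu')⟩
  · intro h s t hst
    rw [smul_smul] at hst
    obtain ⟨h1, h2⟩ := h _ _ hst
    exact ⟨h1, (mul_eq_zero.1 h2).resolve_right hu'⟩

theorem MeetTransversallyAt.mul_right {f g : Form} {p : Point} (h : MeetTransversallyAt f g p)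
    {u : Form} (hu : ¬ Passes u p) : MeetTransversallyAt f (g * u) p :=
  (meetTransversallyAt_mul_right_iff hu).2 h

theorem MeetTransversallyAt.of_mul_left {f g u : Form} {p : Point}
    (h : MeetTransversallyAt (f * u) g p) (hu : ¬ Passes u p) : MeetTransversallyAt f g p :=
  ((meetTransversallyAt_mul_right_iff hu).1 h.symm).symm

theorem MeetTransversallyAt.not_dvd {f g : Form} {p : Point} (h : MeetTransversallyAt f g p) :
    ¬ f ∣ g := by
  rintro ⟨u, rfl⟩
  have hgrad : grad (f * u) p = eval p.rep u • grad f p := by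
    rw [grad_eq_gradAt, gradAt_mul, show eval p.rep f = 0 from h.1, zero_smul, zero_add]
    rfl
  have h2 := h.2.2
  rw [hgrad, LinearIndependent.pair_iff] at h2
  obtain ⟨-, h3⟩ := h2 (eval p.rep u) (-1) (by module)
  exact one_ne_zero (neg_eq_zero.1 h3)

/-- A conic is irreducible or a pair of lines. -/
theorem prime_or_eq_mul {f : Form} (hf : f.IsHomogeneous 2) (hf0 : f ≠ 0) :
    Prime f ∨ ∃ l l' : Form, l.IsHomogeneous 1 ∧ l'.IsHomogeneous 1 ∧ f = l * l' := by
  rw [or_iff_not_imp_left, ← irreducible_iff_prime, irreducible_iff]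
  intro h
  have hdeg := hf.totalDegree hf0
  have hu : ¬ IsUnit f := by
    intro hu
    obtain ⟨g, hg⟩ := hu.exists_right_inv
    have := congrArg totalDegree hg
    rw [totalDegree_mul_of_isDomain hf0 (by rintro rfl; simp at hg), totalDegree_one, hdeg] at this
    omega
  push Not at h
  obtain ⟨a, b, hab, hua, hub⟩ := h hu
  have ha : a ≠ 0 := by rintro rfl; exact hf0 (by rw [hab, zero_mul])
  have hb : b ≠ 0 := by rintro rfl; exact hf0 (by rw [hab, mul_zero])
  have ha1 : a.totalDegree ≠ 0 := fun h0 => hua (isUnit_of_totalDegree_eq_zero ha h0)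
  have hb1 : b.totalDegree ≠ 0 := fun h0 => hub (isUnit_of_totalDegree_eq_zero hb h0)
  rw [hab, totalDegree_mul_of_isDomain ha hb] at hdeg
  have expand : ∀ q : Form, q.totalDegree = 1 →
      q = homogeneousComponent 0 q + homogeneousComponent 1 q := by
    intro q hq
    conv_lhs => rw [← sum_homogeneousComponent q, hq]
    rw [Finset.sum_range_succ, Finset.sum_range_one]
  have hom := fun (i : ℕ) (q : Form) => homogeneousComponent_isHomogeneous i q
  -- The factors have degree one but are not known to be homogeneous; the part of degree two of
  -- their product is the product of their linear parts.
  refine ⟨_, _, hom 1 a, hom 1 b, ?_⟩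
  have key : f = homogeneousComponent 0 a * homogeneousComponent 0 b +
      (homogeneousComponent 0 a * homogeneousComponent 1 b +
      homogeneousComponent 1 a * homogeneousComponent 0 b) +
      homogeneousComponent 1 a * homogeneousComponent 1 b := by
    rw [hab]
    conv_lhs => rw [expand a (by omega), expand b (by omega)]
    ring
  have h00 := (hom 0 a).mul (hom 0 b)
  have h01 := ((hom 0 a).mul (hom 1 b)).add ((hom 1 a).mul (hom 0 b))
  have h11 := (hom 1 a).mul (hom 1 b)
  have h2 := congrArg (homogeneousComponent 2) key
  rw [map_add, map_add, homogeneousComponent_of_mem hf, homogeneousComponent_of_mem h00,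
    homogeneousComponent_of_mem h01, homogeneousComponent_of_mem h11] at h2
  simpa using h2

/-- `f = 0` is the pair of lines `l l' = 0`, which meet in `q`; `w` lies on the first line only and
`w'` on the second line only. -/
structure IsLinePair (f l l' : Form) (w w' q : Point) : Prop where
  hom : l.IsHomogeneous 1
  hom' : l'.IsHomogeneous 1
  eq_mul : f = l * l'
  left : Passes l w
  not_left : ¬ Passes l' w
  right : Passes l' w'
  not_right : ¬ Passes l w'
  meet : MeetTransversallyAt l l' q
  unique : ∀ p, Passes l p → Passes l' p → p = q

namespace IsLinePair

variable {f l l' : Form} {w w' q : Point}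

theorem symm (H : IsLinePair f l l' w w' q) : IsLinePair f l' l w' w q where
  hom := H.hom'
  hom' := H.hom
  eq_mul := by rw [H.eq_mul, mul_comm]
  left := H.right
  not_left := H.not_right
  right := H.left
  not_right := H.not_left
  meet := H.meet.symm
  unique := fun p h h' => H.unique p h' h

theorem isSingularAt (H : IsLinePair f l l' w w' q) : IsSingularAt f q :=
  H.eq_mul ▸ isSingularAt_mul H.meet.1 H.meet.2.1

theorem eq_of_isSingularAt (H : IsLinePair f l l' w w' q) {p : Point} (h : IsSingularAt f p) :
    p = q := by
  obtain ⟨h1, h2⟩ := h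
  rw [H.eq_mul, passes_mul_iff] at h1
  have key : ∀ {a b : Form}, a.IsHomogeneous 1 → a ≠ 0 → f = a * b → Passes a p → Passes b p := by
    intro a b ha ha0 hab hap
    rw [hab, grad_eq_gradAt, gradAt_mul, show eval p.rep a = 0 from hap, zero_smul, zero_add,
      smul_eq_zero] at h2
    exact h2.resolve_right (gradAt_ne_zero_of_isHomogeneous_one ha ha0 _)
  have h0 : l ≠ 0 := by rintro rfl; exact H.not_right (map_zero _)
  have h0' : l' ≠ 0 := by rintro rfl; exact H.not_left (map_zero _)
  rcases h1 with h1 | h1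
  · exact H.unique p h1 (key H.hom h0 H.eq_mul h1)
  · exact H.unique p (key H.hom' h0' H.symm.eq_mul h1) h1

theorem prime (H : IsLinePair f l l' w w' q) : Prime l :=
  prime_of_isHomogeneous_one H.hom (by rintro rfl; exact H.not_right (map_zero _))

theorem isRelPrime (H : IsLinePair f l l' w w' q) : IsRelPrime l l' :=
  H.prime.irreducible.isRelPrime_iff_not_dvd.2 H.meet.not_dvd

end IsLinePair

theorem passes_mk_iff {f : Form} {m : ℕ} (hf : f.IsHomogeneous m) {x : Fin 3 → ℂ} (hx : x ≠ 0) :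
    Passes f (Projectivization.mk ℂ x hx) ↔ eval x f = 0 := by
  obtain ⟨a, ha⟩ := Projectivization.exists_smul_eq_mk_rep ℂ x hx
  rw [Passes, ← ha, Units.smul_def, eval_smul_of_isHomogeneous hf, mul_eq_zero]
  exact ⟨fun h => h.resolve_left (pow_ne_zero _ a.ne_zero), Or.inr⟩

/-- A reduced conic is irreducible or a pair of lines in the position given by two smooth points
that no line in it joins. -/
theorem prime_or_exists_isLinePair {f : Form} (hf : f.IsHomogeneous 2) (hsq : Squarefree f)
    {w w' : Point} (hw : Passes f w) (hw' : Passes f w')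
    (hsep : ∀ l : Form, l.IsHomogeneous 1 → l ∣ f → ¬ (Passes l w ∧ Passes l w')) :
    Prime f ∨ ∃ l l' q, IsLinePair f l l' w w' q := by
  refine (prime_or_eq_mul hf hsq.ne_zero).imp_right ?_
  have main : ∀ l l' : Form, l.IsHomogeneous 1 → l'.IsHomogeneous 1 → f = l * l' → Passes l w →
      ∃ l l' q, IsLinePair f l l' w w' q := by
    intro l l' hl hl' hfl hlw
    have hl0 : l ≠ 0 := by rintro rfl; exact hsq.ne_zero (by rw [hfl, zero_mul])
    have hl0' : l' ≠ 0 := by rintro rfl; exact hsq.ne_zero (by rw [hfl, mul_zero])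
    have h1 : ¬ Passes l w' := fun h => hsep l hl ⟨l', hfl⟩ ⟨hlw, h⟩
    have h2 : Passes l' w' := by
      rw [hfl, passes_mul_iff] at hw'
      exact hw'.resolve_left h1
    have h3 : ¬ Passes l' w := fun h => hsep l' hl' ⟨l, by rw [hfl, mul_comm]⟩ ⟨h, h2⟩
    have hnd : ¬ l ∣ l' := by
      rintro ⟨u, rfl⟩
      exact (prime_of_isHomogeneous_one hl hl0).not_isUnit (hsq l ⟨u, by rw [hfl]; ring⟩)
    have hind : ∀ x, LinearIndependent ℂ ![gradAt l x, gradAt l' x] := by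
      intro x
      rw [LinearIndependent.pair_iff' (gradAt_ne_zero_of_isHomogeneous_one hl hl0 x)]
      intro a ha
      refine hnd ⟨C a, MvPolynomial.funext fun y => ?_⟩
      rw [map_mul, eval_C, eval_eq_dotProduct hl y x, eval_eq_dotProduct hl' y x, ← ha,
        smul_dotProduct, smul_eq_mul, mul_comm]
    set a := gradAt l 0
    set b := gradAt l' 0
    -- The cross product of the coefficient vectors is the intersection point of the two lines.
    have hx : crossProduct a b ≠ 0 := crossProduct_ne_zero_iff_linearIndependent.2 (hind 0)
    have hlq : Passes l (Projectivization.mk ℂ _ hx) := by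
      rw [passes_mk_iff hl, eval_eq_dotProduct hl _ 0]
      exact dot_self_cross a b
    have hlq' : Passes l' (Projectivization.mk ℂ _ hx) := by
      rw [passes_mk_iff hl', eval_eq_dotProduct hl' _ 0]
      exact dot_cross_self a b
    refine ⟨l, l', Projectivization.mk ℂ _ hx, hl, hl', hfl, hlw, h3, h2, h1,
      ⟨hlq, hlq', hind _⟩, fun p hp hp' => ?_⟩
    by_contra hne
    set q : Point := Projectivization.mk ℂ _ hx
    have huv : LinearIndependent ℂ ![p.rep, q.rep] := by
      rw [LinearIndependent.pair_iff' p.rep_nonzero]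
      intro c hc
      refine hne ?_
      rw [← p.mk_rep, ← q.mk_rep, eq_comm, Projectivization.mk_eq_mk_iff']
      exact ⟨c, hc⟩
    refine dotProduct_ne_zero_of_linearIndependent huv (hind 0) ?_ ?_ ?_ ?_
    · rw [← eval_eq_dotProduct hl]; exact hp
    · rw [← eval_eq_dotProduct hl]; exact hlq
    · rw [← eval_eq_dotProduct hl']; exact hp'
    · rw [← eval_eq_dotProduct hl']; exact hlq'
  rintro ⟨l, l', hl, hl', hfl⟩
  have := hw
  rw [hfl, passes_mul_iff] at this
  rcases this with h | h
  · exact main l l' hl hl' hfl h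
  · exact main l' l hl' hl (by rw [hfl, mul_comm]) h

end PlaneCurve

open PlaneCurve

/-! ### Adjoints of a polycon avoid its vertices -/

namespace Polycon

variable {n : ℕ} [NeZero n] {P : Polycon n}

theorem add_one_ne (P : Polycon n) (i : Fin n) : i + 1 ≠ i := by
  intro h
  have h1 : (1 : Fin n) = 0 := by simpa using h
  have h2 := P.two_le
  obtain _ | _ | k := n
  · omega
  · omega
  · exact absurd (congrArg Fin.val h1) (by simp)

theorem cyclic_induction {p : Fin n → Prop} (i : Fin n) (h : p i) (step : ∀ j, p j → p (j + 1))
    (j : Fin n) : p j := by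
  have hall : ∀ k : ℕ, p (i + Fin.ofNat n k) := by
    intro k
    induction k with
    | zero => simpa using h
    | succ k ih =>
      have hk : Fin.ofNat n (k + 1) = Fin.ofNat n k + 1 := by
        ext
        simp [Fin.val_add, Fin.ofNat]
      rw [hk, ← add_assoc]
      exact step _ ih
  simpa using hall (j - i).val

theorem c_ne_zero (P : Polycon n) (i : Fin n) : P.c i ≠ 0 := (P.reduced_c i).ne_zero

theorem isHomogeneous_c (P : Polycon n) (i : Fin n) :
    (P.c i).IsHomogeneous (P.c i).totalDegree := by
  rcases P.degree_c i with h | h <;> rwa [h.totalDegree (P.c_ne_zero i)]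

theorem totalDegree_c (P : Polycon n) (i : Fin n) :
    (P.c i).totalDegree = 1 ∨ (P.c i).totalDegree = 2 :=
  (P.degree_c i).imp (fun h => h.totalDegree (P.c_ne_zero i)) fun h => h.totalDegree (P.c_ne_zero i)

/-- The product of all boundary components but one. -/
noncomputable def compl (P : Polycon n) (i : Fin n) : Form := ∏ j ∈ Finset.univ.erase i, P.c j

theorem c_mul_compl (P : Polycon n) (i : Fin n) : P.c i * P.compl i = P.boundary :=
  Finset.mul_prod_erase _ _ (Finset.mem_univ i)

theorem boundary_ne_zero (P : Polycon n) : P.boundary ≠ 0 :=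
  Finset.prod_ne_zero_iff.2 fun i _ => P.c_ne_zero i

theorem isHomogeneous_compl (P : Polycon n) (i : Fin n) :
    (P.compl i).IsHomogeneous (∑ j ∈ Finset.univ.erase i, (P.c j).totalDegree) :=
  IsHomogeneous.prod _ _ _ fun j _ => P.isHomogeneous_c j

theorem degree_eq {E h : Form} {δ m : ℕ} (hE : E.IsHomogeneous δ) (hh : h.IsHomogeneous m)
    (hP : E * h = P.boundary) : P.degree = δ + m := by
  rw [degree, ← hP]
  exact (hE.mul hh).totalDegree (hP ▸ P.boundary_ne_zero)

theorem passes_compl_iff {i : Fin n} {p : Point} :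
    Passes (P.compl i) p ↔ ∃ j, j ≠ i ∧ Passes (P.c j) p := by
  simp [compl, passes_prod_iff]

theorem passes_boundary_iff {p : Point} : Passes P.boundary p ↔ ∃ j, Passes (P.c j) p := by
  simp [boundary, passes_prod_iff]

theorem passes_c_v (P : Polycon n) (i : Fin n) : Passes (P.c i) (P.v i) := (P.transversal i).1

theorem passes_c_v_sub_one (P : Polycon n) (i : Fin n) : Passes (P.c i) (P.v (i - 1)) := by
  simpa using (P.transversal (i - 1)).2.1

theorem eq_or_eq_of_passes {i j : Fin n} (h : Passes (P.c i) (P.v j)) : j = i - 1 ∨ j = i := by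
  by_contra! hc
  exact P.not_passes j i hc.2.symm (fun h1 => hc.1 (by rw [h1, add_sub_cancel_right])) h

theorem meet_right (P : Polycon n) (i : Fin n) :
    MeetTransversallyAt (P.c i) (P.compl i) (P.v i) := by
  have h1 : i + 1 ∈ Finset.univ.erase i := by simp [P.add_one_ne i]
  rw [compl, ← Finset.mul_prod_erase _ _ h1]
  refine (P.transversal i).mul_right ?_
  rw [passes_prod_iff]
  rintro ⟨j, hj, h⟩
  simp only [Finset.mem_erase, Finset.mem_univ, and_true] at hj
  exact P.not_passes i j hj.2 hj.1 h

theorem meet_left (P : Polycon n) (i : Fin n) :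
    MeetTransversallyAt (P.c i) (P.compl i) (P.v (i - 1)) := by
  have h0 := P.transversal (i - 1)
  rw [sub_add_cancel] at h0
  have h1 : i - 1 ∈ Finset.univ.erase i := by
    have := P.add_one_ne (i - 1)
    rw [sub_add_cancel] at this
    simp only [Finset.mem_erase, Finset.mem_univ, and_true]
    exact this.symm
  rw [compl, ← Finset.mul_prod_erase _ _ h1]
  refine h0.symm.mul_right ?_
  rw [passes_prod_iff]
  rintro ⟨j, hj, h⟩
  simp only [Finset.mem_erase, Finset.mem_univ, and_true] at hj
  exact P.not_passes (i - 1) j hj.1 (by rw [sub_add_cancel]; exact hj.2) h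

/-- A boundary component is irreducible or a pair of lines. -/
theorem prime_or_exists_isLinePair (hsep : P.SeparatesVertices) (i : Fin n) :
    Prime (P.c i) ∨ ∃ l l' q, IsLinePair (P.c i) l l' (P.v (i - 1)) (P.v i) q := by
  rcases P.degree_c i with h | h
  · exact Or.inl (prime_of_isHomogeneous_one h (P.c_ne_zero i))
  · exact PlaneCurve.prime_or_exists_isLinePair h (P.reduced_c i) (P.passes_c_v_sub_one i)
      (P.passes_c_v i) (hsep i h)

theorem not_isSingularAt_of_prime {i : Fin n} (hi : Prime (P.c i)) (p : Point) :
    ¬ IsSingularAt (P.c i) p := by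
  rintro ⟨hp, hg⟩
  rcases P.degree_c i with h | h
  · exact gradAt_ne_zero_of_isHomogeneous_one h (P.c_ne_zero i) _ hg
  · exact gradAt_ne_zero_of_prime h hi p.rep_nonzero hp hg

/-- The data of an adjoint polynomial of degree `e` of a polycon in sufficiently general
position. -/
structure GoodAdjoint (P : Polycon n) (α : Form) (e : ℕ) : Prop where
  sep : P.SeparatesVertices
  free : P.ImplicitVerticesFree
  ne_zero : α ≠ 0
  hom : α.IsHomogeneous e
  add_three : e + 3 = P.degree
  conductor : ∀ p ∈ P.residual, InConductorAt P.boundary α p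

namespace GoodAdjoint

variable {α : Form} {e : ℕ}

theorem edge_of_prime (G : P.GoodAdjoint α e) {i : Fin n} (hi : Prime (P.c i)) :
    AdjointEdge (P.c i) (P.compl i) α (P.c i).totalDegree
      (∑ j ∈ Finset.univ.erase i, (P.c j).totalDegree) e (P.v (i - 1)) (P.v i) where
  prime := hi
  degree := P.totalDegree_c i
  homE := P.isHomogeneous_c i
  homh := P.isHomogeneous_compl i
  homα := G.hom
  add_three := by
    rw [G.add_three, degree_eq (P.isHomogeneous_c i) (P.isHomogeneous_compl i) (P.c_mul_compl i)]
  not_dvd := (P.meet_left i).not_dvd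
  ne := P.vertex_ne i
  left := P.meet_left i
  right := P.meet_right i
  conductor := by
    intro p hp hp' h1 h2
    rw [P.c_mul_compl i]
    refine G.conductor p ⟨P.c_mul_compl i ▸ isSingularAt_mul hp hp', ?_⟩
    rintro (⟨j, rfl⟩ | ⟨j, hj⟩)
    · rcases eq_or_eq_of_passes hp with rfl | rfl
      · exact h1 rfl
      · exact h2 rfl
    · rcases eq_or_ne i j with rfl | hij
      · exact not_isSingularAt_of_prime hi p hj
      · exact G.free j p hj i hij hp

/-- The line pair is cut at its implicit vertex `q`, which becomes the second vertex of the edge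
`l`, and `l'` joins the complement. The field `free` keeps the other components away from `q`, so
that the crossing there is transversal. -/
theorem edge_of_isLinePair_aux (G : P.GoodAdjoint α e) {i : Fin n} {l l' : Form} {w w' q : Point}
    (H : IsLinePair (P.c i) l l' w w' q) (hw : MeetTransversallyAt (P.c i) (P.compl i) w)
    (hv : ∀ j, Passes (P.c i) (P.v j) → P.v j = w ∨ P.v j = w') :
    AdjointEdge l (l' * P.compl i) α 1
      (1 + ∑ j ∈ Finset.univ.erase i, (P.c j).totalDegree) e w q := by
  have hmul : l * (l' * P.compl i) = P.boundary := by
    rw [← mul_assoc, ← H.eq_mul, P.c_mul_compl]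
  have hleft : MeetTransversallyAt l (l' * P.compl i) w := by
    rw [H.eq_mul] at hw
    rw [mul_comm]
    exact (hw.of_mul_left H.not_left).mul_right H.not_left
  have hhom := H.hom'.mul (P.isHomogeneous_compl i)
  exact
  { prime := H.prime
    degree := Or.inl rfl
    homE := H.hom
    homh := hhom
    homα := G.hom
    add_three := by rw [G.add_three, degree_eq H.hom hhom hmul]
    not_dvd := hleft.not_dvd
    ne := by rintro rfl; exact H.not_left H.meet.2.1
    left := hleft
    right := by
      refine H.meet.mul_right ?_
      rw [passes_compl_iff]
      rintro ⟨j, hj, h⟩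
      exact G.free i q H.isSingularAt j hj h
    conductor := by
      intro p hp hp' h1 h2
      rw [hmul]
      refine G.conductor p ⟨hmul ▸ isSingularAt_mul hp hp', ?_⟩
      have hpc : Passes (P.c i) p := H.eq_mul ▸ hp.mul_left l'
      rintro (⟨j, rfl⟩ | ⟨j, hj⟩)
      · rcases hv j hpc with h | h
        · exact h1 h
        · exact H.not_right (h ▸ hp)
      · rcases eq_or_ne i j with rfl | hij
        · exact h2 (H.eq_of_isSingularAt hj)
        · exact G.free j p hj i hij hpc }

theorem edge_left (G : P.GoodAdjoint α e) {i : Fin n} {l l' : Form} {q : Point}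
    (H : IsLinePair (P.c i) l l' (P.v (i - 1)) (P.v i) q) :
    AdjointEdge l (l' * P.compl i) α 1
      (1 + ∑ j ∈ Finset.univ.erase i, (P.c j).totalDegree) e (P.v (i - 1)) q :=
  G.edge_of_isLinePair_aux H (P.meet_left i) fun _ hj =>
    (eq_or_eq_of_passes hj).imp (congrArg P.v) (congrArg P.v)

theorem edge_right (G : P.GoodAdjoint α e) {i : Fin n} {l l' : Form} {q : Point}
    (H : IsLinePair (P.c i) l l' (P.v (i - 1)) (P.v i) q) :
    AdjointEdge l' (l * P.compl i) α 1
      (1 + ∑ j ∈ Finset.univ.erase i, (P.c j).totalDegree) e (P.v i) q :=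
  G.edge_of_isLinePair_aux H.symm (P.meet_right i) fun _ hj =>
    ((eq_or_eq_of_passes hj).imp (congrArg P.v) (congrArg P.v)).symm

/-- On an irreducible component this is the edge dichotomy. In a line pair, vanishing is carried
from one line to the other by the implicit vertex, an end of both edges. -/
theorem passes_v_sub_one_iff (G : P.GoodAdjoint α e) (i : Fin n) :
    (Passes α (P.v (i - 1)) ↔ P.c i ∣ α) ∧ (Passes α (P.v i) ↔ P.c i ∣ α) := by
  rcases prime_or_exists_isLinePair G.sep i with hi | ⟨l, l', q, H⟩
  · exact ⟨(G.edge_of_prime hi).passes_left_iff, (G.edge_of_prime hi).passes_right_iff⟩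
  · have h1 := (G.edge_left H).passes_left_iff
    have h2 := (G.edge_left H).passes_right_iff
    have h3 := (G.edge_right H).passes_left_iff
    have h4 := (G.edge_right H).passes_right_iff
    have h5 : P.c i ∣ α ↔ l ∣ α ∧ l' ∣ α := by
      rw [H.eq_mul]
      exact ⟨fun h => ⟨(dvd_mul_right _ _).trans h, (dvd_mul_left _ _).trans h⟩,
        fun h => H.isRelPrime.mul_dvd h.1 h.2⟩
    rw [h5, h1, h3]
    have h6 := h2.symm.trans h4
    tauto

/-- Every irreducible piece of a component contains an explicit vertex, at which it is transversal
to the rest of the boundary, so it cannot divide another component. -/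
theorem isRelPrime_c (hsep : P.SeparatesVertices) {i j : Fin n} (hij : i ≠ j) :
    IsRelPrime (P.c i) (P.c j) := by
  have hdvd : P.c j ∣ P.compl i :=
    Finset.dvd_prod_of_mem _ (Finset.mem_erase.2 ⟨hij.symm, Finset.mem_univ _⟩)
  rcases prime_or_exists_isLinePair hsep i with hi | ⟨l, l', q, H⟩
  · exact hi.irreducible.isRelPrime_iff_not_dvd.2 fun h => (P.meet_left i).not_dvd (h.trans hdvd)
  · have h1 := P.meet_left i
    have h2 := P.meet_right i
    rw [H.eq_mul] at h1 h2
    rw [mul_comm] at h2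
    rw [H.eq_mul]
    refine IsRelPrime.mul_left ?_ ?_
    · exact H.prime.irreducible.isRelPrime_iff_not_dvd.2 fun h =>
        (h1.of_mul_left H.not_left).not_dvd (h.trans hdvd)
    · exact H.symm.prime.irreducible.isRelPrime_iff_not_dvd.2 fun h =>
        (h2.of_mul_left H.not_right).not_dvd (h.trans hdvd)

theorem prod_dvd (hsep : P.SeparatesVertices) {s : Finset (Fin n)} {f : Form}
    (h : ∀ i ∈ s, P.c i ∣ f) : ∏ i ∈ s, P.c i ∣ f :=
  Finset.prod_dvd_of_isRelPrime (fun _ _ _ _ hij => isRelPrime_c hsep hij) h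

/-- An adjoint curve passes through no explicit vertex. -/
theorem not_passes_v (G : P.GoodAdjoint α e) (i : Fin n) : ¬ Passes α (P.v i) := by
  intro h
  have step : ∀ j, Passes α (P.v (j - 1)) ↔ Passes α (P.v j) := fun j =>
    (G.passes_v_sub_one_iff j).1.trans (G.passes_v_sub_one_iff j).2.symm
  have hall : ∀ j, Passes α (P.v j) := cyclic_induction i h fun j hj =>
    (step (j + 1)).1 (by rwa [add_sub_cancel_right])
  have hdvd : P.boundary ∣ α := prod_dvd G.sep fun j _ => (G.passes_v_sub_one_iff j).2.1 (hall j)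
  -- A nonzero form of degree three less than the boundary cannot be a multiple of it.
  obtain ⟨u, rfl⟩ := hdvd
  have hu := right_ne_zero_of_mul G.ne_zero
  have h1 := G.hom.totalDegree G.ne_zero
  rw [totalDegree_mul_of_isDomain P.boundary_ne_zero hu] at h1
  have h2 := G.add_three
  rw [degree] at h2
  omega

theorem not_c_dvd (G : P.GoodAdjoint α e) (i : Fin n) : ¬ P.c i ∣ α := fun h =>
  G.not_passes_v i ((G.passes_v_sub_one_iff i).2.2 h)

/-- An adjoint curve contains no line of a line pair in the boundary. -/
theorem not_dvd_of_isLinePair (G : P.GoodAdjoint α e) {i : Fin n} {l l' : Form} {q : Point}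
    (H : IsLinePair (P.c i) l l' (P.v (i - 1)) (P.v i) q) : ¬ l ∣ α ∧ ¬ l' ∣ α :=
  ⟨fun h => G.not_passes_v _ ((G.edge_left H).passes_left_iff.2 h),
    fun h => G.not_passes_v _ ((G.edge_right H).passes_left_iff.2 h)⟩

/-- An adjoint curve passes through no vertex. -/
theorem not_passes_of_mem_vertices (G : P.GoodAdjoint α e) {p : Point} (hp : p ∈ P.vertices) :
    ¬ Passes α p := by
  rcases hp with ⟨j, rfl⟩ | ⟨i, hi⟩
  · exact G.not_passes_v j
  · rcases prime_or_exists_isLinePair G.sep i with h | ⟨l, l', q, H⟩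
    · exact absurd hi (not_isSingularAt_of_prime h p)
    · rw [H.eq_of_isSingularAt hi, (G.edge_left H).passes_right_iff]
      exact (G.not_dvd_of_isLinePair H).1

/-- At a common point of an adjoint curve and a boundary component, the adjoint curve meets the
component in a residual point, transversally if the boundary has a node there. -/
theorem exists_component (G : P.GoodAdjoint α e) {i : Fin n} {p : Point} (hi : Passes (P.c i) p)
    (hp : Passes α p) : ∃ E u : Form, ∃ δ : ℕ, P.c i = E * u ∧ E.IsHomogeneous δ ∧ Prime E ∧
      ¬ E ∣ α ∧ Passes E p ∧ Passes (u * P.compl i) p ∧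
      (MeetTransversallyAt E (u * P.compl i) p → MeetTransversallyAt E α p) := by
  rcases prime_or_exists_isLinePair G.sep i with h | ⟨l, l', q, H⟩
  · have hE := G.edge_of_prime h
    have := hE.passes_of_passes (G.not_c_dvd i) hi hp
    exact ⟨P.c i, 1, _, (mul_one _).symm, hE.homE, h, G.not_c_dvd i, hi, by rwa [one_mul]⟩
  · have hi' := hi
    rw [H.eq_mul, passes_mul_iff] at hi'
    rcases hi' with hl | hl
    · have hE := G.edge_left H
      have hnd := (G.not_dvd_of_isLinePair H).1
      exact ⟨l, l', 1, H.eq_mul, hE.homE, hE.prime, hnd, hl, hE.passes_of_passes hnd hl hp⟩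
    · have hE := G.edge_right H
      have hnd := (G.not_dvd_of_isLinePair H).2
      exact ⟨l', l, 1, H.symm.eq_mul, hE.homE, hE.prime, hnd, hl, hE.passes_of_passes hnd hl hp⟩

theorem finite_setOf_passes (G : P.GoodAdjoint α e) (i : Fin n) :
    {p | Passes (P.c i) p ∧ Passes α p}.Finite := by
  rcases prime_or_exists_isLinePair G.sep i with h | ⟨l, l', q, H⟩
  · exact (G.edge_of_prime h).finite_setOf_passes (G.not_c_dvd i)
  · obtain ⟨h1, h2⟩ := G.not_dvd_of_isLinePair H
    refine (((G.edge_left H).finite_setOf_passes h1).union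
      ((G.edge_right H).finite_setOf_passes h2)).subset ?_
    rintro p ⟨hp, hp'⟩
    rw [H.eq_mul, passes_mul_iff] at hp
    exact hp.imp (fun h => ⟨h, hp'⟩) fun h => ⟨h, hp'⟩

end GoodAdjoint

end Polycon

/-! ### The identity relating the two adjoints -/

namespace Polycon

variable {n : ℕ} [NeZero n] {P P' : Polycon n} {k : Fin n} {α α' : Form} {e e' : ℕ}

/-- At a node lying on a component and on its complement, both gradients are nonzero, so the
component is smooth there. -/
theorem implicitVerticesFree_of_isNodal (hP : P.IsNodal) : P.ImplicitVerticesFree := by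
  intro i p hi j hij hj
  have hc : Passes (P.compl i) p := passes_compl_iff.2 ⟨j, hij, hj⟩
  have hnode := hP p (P.c_mul_compl i ▸ isSingularAt_mul hi.1 hc)
  rw [← P.c_mul_compl i] at hnode
  exact (hnode.linearIndependent hi.1 hc).ne_zero 0 hi.2

theorem exists_compl_eq (P : Polycon n) {i j : Fin n} (hij : i ≠ j) :
    P.compl i = P.c j * ∏ a ∈ (Finset.univ.erase i).erase j, P.c a :=
  (Finset.mul_prod_erase _ _ (Finset.mem_erase.2 ⟨hij.symm, Finset.mem_univ j⟩)).symm

/-- A singular point of the boundary that is not a vertex is a common point of two components. -/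
theorem passes_compl_of_mem_residual {p : Point} (hp : p ∈ P.residual) {i : Fin n}
    (hi : Passes (P.c i) p) : Passes (P.compl i) p := by
  by_contra hc
  obtain ⟨⟨-, h2⟩, h3⟩ := hp
  rw [← P.c_mul_compl i, grad_eq_gradAt, gradAt_mul, show eval p.rep (P.c i) = 0 from hi,
    zero_smul, zero_add, smul_eq_zero] at h2
  exact h3 (Or.inr ⟨i, hi, h2.resolve_left hc⟩)

/-- The conductor is contained in the ideal generated by a component and its complement, both of
which vanish at a residual point. -/
theorem GoodAdjoint.passes_of_mem_residual (G : P.GoodAdjoint α e) {p : Point}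
    (hp : p ∈ P.residual) : Passes α p := by
  obtain ⟨i, hi⟩ := passes_boundary_iff.1 hp.1.1
  have hi' := passes_compl_of_mem_residual hp hi
  have hrel : IsRelPrime (P.c i) (P.compl i) := IsRelPrime.prod_right fun j hj =>
    GoodAdjoint.isRelPrime_c G.sep (Finset.ne_of_mem_erase hj).symm
  have hc := G.conductor p hp
  rw [← P.c_mul_compl i] at hc
  obtain ⟨d, a, b, hd, hab⟩ := exists_mul_eq_of_mem_span
    (hc.mem_span hrel (right_ne_zero_of_mul (P.c_mul_compl i ▸ P.boundary_ne_zero)))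
  obtain ⟨t, ht, hdt⟩ := exists_eval_smul_ne_zero hd
  have h1 := congrArg (eval (t • p.rep)) hab
  rw [map_add, map_mul, map_mul, map_mul, eval_smul_of_isHomogeneous (P.isHomogeneous_c i),
    eval_smul_of_isHomogeneous (P.isHomogeneous_compl i), eval_smul_of_isHomogeneous G.hom,
    show eval p.rep (P.c i) = 0 from hi, show eval p.rep (P.compl i) = 0 from hi',
    mul_zero, mul_zero, mul_zero, mul_zero, add_zero] at h1
  exact (mul_eq_zero.1 ((mul_eq_zero.1 h1).resolve_left hdt)).resolve_left (pow_ne_zero _ ht)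

namespace IsLineReplacement

theorem prod_eq (hrepl : P.IsLineReplacement P' k) {s : Finset (Fin n)} (hs : k ∉ s) :
    ∏ j ∈ s, P'.c j = ∏ j ∈ s, P.c j :=
  Finset.prod_congr rfl fun j hj => hrepl.other j fun h => hs (h ▸ hj)

theorem compl_eq (hrepl : P.IsLineReplacement P' k) : P'.compl k = P.compl k :=
  hrepl.prod_eq (Finset.notMem_erase k _)

theorem compl_mul_eq (hrepl : P.IsLineReplacement P' k) {i : Fin n} (hik : i ≠ k) :
    P.compl i * P'.c k = P'.compl i * P.c k := by
  rw [P.exists_compl_eq hik, P'.exists_compl_eq hik, hrepl.prod_eq (Finset.notMem_erase k _)]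
  ring

theorem separatesVertices (hrepl : P.IsLineReplacement P' k) (hsep : P.SeparatesVertices) :
    P'.SeparatesVertices := by
  intro i hi
  have hik : i ≠ k := by
    rintro rfl
    exact absurd (hrepl.line.inj_right hi (P'.c_ne_zero i)) (by norm_num)
  rw [hrepl.other i hik] at hi ⊢
  rw [hrepl.vertex]
  exact hsep i hi

theorem passes_line (hrepl : P.IsLineReplacement P' k) :
    Passes (P'.c k) (P.v (k - 1)) ∧ Passes (P'.c k) (P.v k) := by
  rw [← hrepl.vertex]
  exact ⟨P'.passes_c_v_sub_one k, P'.passes_c_v k⟩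

theorem not_dvd (hrepl : P.IsLineReplacement P' k) (hsep : P.SeparatesVertices) :
    ¬ P'.c k ∣ P.c k := fun h => hsep k hrepl.conic _ hrepl.line h hrepl.passes_line

theorem prime_line (hrepl : P.IsLineReplacement P' k) : Prime (P'.c k) :=
  prime_of_isHomogeneous_one hrepl.line (P'.c_ne_zero k)

/-- The line meets the conic that it replaces in the two explicit vertices only. -/
theorem eq_or_eq (hrepl : P.IsLineReplacement P' k) (hsep : P.SeparatesVertices) {p : Point}
    (hc : Passes (P.c k) p) (hl : Passes (P'.c k) p) : p = P.v (k - 1) ∨ p = P.v k := by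
  have ext_of : ∀ {p q : Point} {c : ℂ}, p.rep = c • q.rep → p = q := by
    intro p q c h
    rw [← p.mk_rep, ← q.mk_rep, Projectivization.mk_eq_mk_iff']
    exact ⟨c, h.symm⟩
  set x := (P.v (k - 1)).rep
  set y := (P.v k).rep
  obtain ⟨hlx, hly⟩ := hrepl.passes_line
  have hcx : eval x (P.c k) = 0 := P.passes_c_v_sub_one k
  have hcy : eval y (P.c k) = 0 := P.passes_c_v k
  have hxy : LinearIndependent ℂ ![x, y] := by
    rw [LinearIndependent.pair_iff' (P.v (k - 1)).rep_nonzero]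
    intro c h
    exact P.vertex_ne k (ext_of h.symm).symm
  have hg0 := gradAt_ne_zero_of_isHomogeneous_one hrepl.line (P'.c_ne_zero k) 0
  have hspan : ∀ z, eval z (P'.c k) = 0 → ∃ a b : ℂ, z = a • x + b • y := fun z hz =>
    exists_eq_add_smul_of_dotProduct_eq_zero hg0 hxy
      (by rw [dotProduct_comm, ← eval_eq_dotProduct hrepl.line]; exact hlx)
      (by rw [dotProduct_comm, ← eval_eq_dotProduct hrepl.line]; exact hly)
      (by rw [dotProduct_comm, ← eval_eq_dotProduct hrepl.line]; exact hz)
  -- On the line, the conic becomes `a b` times a constant. The constant is nonzero since the conic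
  -- does not contain the line.
  have hev : ∀ a b : ℂ, eval (a • x + b • y) (P.c k) = a * b * polar (P.c k) x y := by
    intro a b
    rw [eval_add_smul hrepl.conic, hcx, hcy]
    ring
  have hpolar : polar (P.c k) x y ≠ 0 := by
    intro h0
    refine hrepl.not_dvd hsep (dvd_of_forall_eval_eq_zero hrepl.prime_line fun z hz => ?_)
    obtain ⟨a, b, rfl⟩ := hspan z hz
    rw [hev, h0, mul_zero]
  obtain ⟨a, b, hab⟩ := hspan p.rep hl
  have h0 : eval p.rep (P.c k) = 0 := hc
  rw [hab, hev, mul_eq_zero, or_iff_left hpolar, mul_eq_zero] at h0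
  rcases h0 with rfl | rfl
  · exact Or.inr (ext_of (c := b) (by rw [hab, zero_smul, zero_add]))
  · exact Or.inl (ext_of (c := a) (by rw [hab, zero_smul, add_zero]))

/-- This gives `μ ≠ 0` below. In the line-pair case, a line of the conic not dividing `α` would have
to be the replacing line, which joins both vertices. -/
theorem conic_not_dvd (hrepl : P.IsLineReplacement P' k) (G : P.GoodAdjoint α e) :
    ¬ P.c k ∣ α * P'.c k := by
  intro h
  rcases prime_or_exists_isLinePair G.sep k with hk | ⟨l, l', q, H⟩
  · exact (hk.dvd_or_dvd h).elim (G.not_c_dvd k)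
      (not_dvd_of_isHomogeneous_one hrepl.conic hrepl.line (P'.c_ne_zero k))
  · have h1 : l ∣ α * P'.c k := (Dvd.intro _ H.eq_mul.symm).trans h
    have h2 := (H.prime.dvd_or_dvd h1).resolve_left (G.not_dvd_of_isLinePair H).1
    have h3 := ((H.prime.dvd_prime_iff_associated hrepl.prime_line).1 h2).symm.dvd
    exact hrepl.not_dvd G.sep (h3.trans (Dvd.intro _ H.eq_mul.symm))

theorem degree_add (hrepl : P.IsLineReplacement P' k) (G : P.GoodAdjoint α e)
    (G' : P'.GoodAdjoint α' e') : e + 1 = e' + 2 ∧ (P.compl k).IsHomogeneous (e + 1) := by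
  have h1 := degree_eq hrepl.conic (P.isHomogeneous_compl k) (P.c_mul_compl k)
  have h2 := degree_eq hrepl.line (hrepl.compl_eq ▸ P.isHomogeneous_compl k) (P'.c_mul_compl k)
  have h3 := P.isHomogeneous_compl k
  have h4 := G.add_three
  have h5 := G'.add_three
  refine ⟨by omega, ?_⟩
  convert h3 using 1
  omega

/-- On each common boundary component, the two adjoints, multiplied with the equations of the line
and of the conic, are proportional. -/
theorem exists_dvd_sub (hrepl : P.IsLineReplacement P' k) (G : P.GoodAdjoint α e)
    (G' : P'.GoodAdjoint α' e') {i : Fin n} (hik : i ≠ k) :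
    ∃ r : ℂ, r ≠ 0 ∧ P.c i ∣ α * P'.c k - C r * (α' * P.c k) := by
  have hdeg := (hrepl.degree_add G G').1
  have hhom := G.hom.mul hrepl.line
  have hhom' : (α' * P.c k).IsHomogeneous (e + 1) := hdeg ▸ G'.hom.mul hrepl.conic
  have hcompl := hrepl.compl_mul_eq hik
  have hci := hrepl.other i hik
  rcases prime_or_exists_isLinePair G.sep i with hi | ⟨l, l', q, H⟩
  · have hE := G.edge_of_prime hi
    have hE' := G'.edge_of_prime (i := i) (by rwa [hci])
    rw [hci, hrepl.vertex] at hE'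
    exact hE.exists_dvd_sub hE' (G.not_c_dvd i) (hci ▸ G'.not_c_dvd i) hcompl hhom hhom'
  · have H' : IsLinePair (P'.c i) l l' (P'.v (i - 1)) (P'.v i) q := by
      rwa [hci, hrepl.vertex]
    obtain ⟨hd, hd'⟩ := G.not_dvd_of_isLinePair H
    obtain ⟨hd₁, hd₁'⟩ := G'.not_dvd_of_isLinePair H'
    have hL' := G'.edge_left H'
    have hR' := G'.edge_right H'
    have hq : ¬ Passes α' q := fun h => hd₁ (hL'.passes_right_iff.1 h)
    have hqc : ¬ Passes (P.c k) q := G.free i q H.isSingularAt k hik.symm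
    rw [hrepl.vertex] at hL' hR'
    obtain ⟨r, hr, hl⟩ := (G.edge_left H).exists_dvd_sub hL' hd hd₁
      (l := P'.c k) (c := P.c k) (by rw [mul_assoc, mul_assoc, hcompl]) hhom hhom'
    obtain ⟨s, -, hl'⟩ := (G.edge_right H).exists_dvd_sub hR' hd' hd₁'
      (l := P'.c k) (c := P.c k) (by rw [mul_assoc, mul_assoc, hcompl]) hhom hhom'
    -- The two lines give separate constants. Both congruences hold at `q`, where `α'` and the conic
    -- are nonzero, so the constants agree.
    have hrs : r = s := by
      have h1 : eval q.rep (α * P'.c k - C r * (α' * P.c k)) = 0 := by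
        obtain ⟨u, hu⟩ := hl
        rw [hu, map_mul, show eval q.rep l = 0 from H.meet.1, zero_mul]
      have h2 : eval q.rep (α * P'.c k - C s * (α' * P.c k)) = 0 := by
        obtain ⟨u, hu⟩ := hl'
        rw [hu, map_mul, show eval q.rep l' = 0 from H.meet.2.1, zero_mul]
      simp only [map_sub, map_mul, eval_C] at h1 h2
      refine mul_right_cancel₀ (mul_ne_zero (show eval q.rep α' ≠ 0 from hq)
        (show eval q.rep (P.c k) ≠ 0 from hqc)) ?_
      linear_combination h2 - h1
    subst hrs
    exact ⟨r, hr, by rw [H.eq_mul]; exact H.isRelPrime.mul_dvd hl hl'⟩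

/-- The two adjoints satisfy a linear relation with the equations of the conic, of the line and of
the common boundary components. -/
theorem exists_relation (hrepl : P.IsLineReplacement P' k) (G : P.GoodAdjoint α e)
    (G' : P'.GoodAdjoint α' e') : ∃ r μ : ℂ, r ≠ 0 ∧ μ ≠ 0 ∧
      α * P'.c k - C r * (α' * P.c k) = C μ * P.compl k := by
  have hr : ∀ i, ∃ r : ℂ, i ≠ k → r ≠ 0 ∧ P.c i ∣ α * P'.c k - C r * (α' * P.c k) := by
    intro i
    by_cases hik : i = k
    · exact ⟨0, fun h => absurd hik h⟩
    · obtain ⟨r, hr⟩ := hrepl.exists_dvd_sub G G' hik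
      exact ⟨r, fun _ => hr⟩
  choose r hr using hr
  -- Consecutive components share the vertex `P.v i`, at which neither `α'` nor the conic vanishes.
  have hstep : ∀ i, i ≠ k → i + 1 ≠ k → r (i + 1) = r i := by
    intro i hi hi1
    have hev : ∀ j, j ≠ k → Passes (P.c j) (P.v i) →
        eval (P.v i).rep (α * P'.c k - C (r j) * (α' * P.c k)) = 0 := by
      intro j hj hp
      obtain ⟨u, hu⟩ := (hr j hj).2
      rw [hu, map_mul, show eval (P.v i).rep (P.c j) = 0 from hp, zero_mul]
    have h1 := hev i hi (P.passes_c_v i)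
    have h2 := hev (i + 1) hi1 (P.transversal i).2.1
    have h3 : eval (P.v i).rep α' ≠ 0 := hrepl.vertex ▸ G'.not_passes_v i
    have h4 : eval (P.v i).rep (P.c k) ≠ 0 := P.not_passes i k hi.symm hi1.symm
    simp only [map_sub, map_mul, eval_C] at h1 h2
    refine mul_right_cancel₀ (mul_ne_zero h3 h4) ?_
    linear_combination h1 - h2
  have hconst : ∀ i, i = k ∨ r i = r (k + 1) :=
    cyclic_induction k (Or.inl rfl) fun j hj => by
      by_cases hjk : j = k
      · exact Or.inr (by rw [hjk])
      by_cases hj1 : j + 1 = k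
      · exact Or.inl hj1
      · exact Or.inr ((hstep j hjk hj1).trans (hj.resolve_left hjk))
  have hdvd : P.compl k ∣ α * P'.c k - C (r (k + 1)) * (α' * P.c k) :=
    GoodAdjoint.prod_dvd G.sep fun i hi => by
      have hik := Finset.ne_of_mem_erase hi
      rw [← (hconst i).resolve_left hik]
      exact (hr i hik).2
  have hr0 := (hr (k + 1) (P.add_one_ne k)).1
  obtain ⟨hdeg, hcompl⟩ := hrepl.degree_add G G'
  have hβ0 : α * P'.c k - C (r (k + 1)) * (α' * P.c k) ≠ 0 := by
    intro h0
    exact hrepl.conic_not_dvd G ⟨C (r (k + 1)) * α', by rw [sub_eq_zero.1 h0]; ring⟩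
  have hhom' : (α' * P.c k).IsHomogeneous (e + 1) := hdeg ▸ G'.hom.mul hrepl.conic
  have hβ := ((G.hom.mul hrepl.line).sub (hhom'.C_mul (r (k + 1)))).totalDegree hβ0
  obtain ⟨u, hu⟩ := hdvd
  rw [hu] at hβ0 hβ
  have hg0 := left_ne_zero_of_mul hβ0
  have hu0 := right_ne_zero_of_mul hβ0
  rw [totalDegree_mul_of_isDomain hg0 hu0, hcompl.totalDegree hg0] at hβ
  -- Both sides have degree `e + 1`, so the cofactor is a constant.
  obtain ⟨μ, rfl⟩ : ∃ μ, u = C μ := ⟨_, totalDegree_eq_zero_iff_eq_C.1 (by omega)⟩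
  exact ⟨r (k + 1), μ, hr0, fun h0 => hu0 (by rw [h0, C_0]), by rw [hu, mul_comm]⟩

end IsLineReplacement

end Polycon

/-! ### Point divisors and intersection multiplicities -/

namespace PlaneCurve

theorem pointDivisor_apply_of_mem {s : Finset Point} {p : Point} (hp : p ∈ s) :
    pointDivisor s p = 1 := by
  classical
  rw [pointDivisor, Finsupp.finsetSum_apply, Finset.sum_eq_single p]
  · simp
  · intro q _ hq; simp [hq]
  · exact fun h => absurd hp h

theorem pointDivisor_apply_of_notMem {s : Finset Point} {p : Point} (hp : p ∉ s) :
    pointDivisor s p = 0 := by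
  classical
  rw [pointDivisor, Finsupp.finsetSum_apply]
  refine Finset.sum_eq_zero fun q hq => ?_
  have : q ≠ p := by rintro rfl; exact hp hq
  simp [this]

theorem intersectionMultiplicity_eq_zero {f g : Form} {p : Point}
    (h : ¬ Passes f p ∨ ¬ Passes g p) : intersectionMultiplicity f g p = 0 := by
  have htop : Ideal.span {algebraMap Form (LocalRing p) f, algebraMap Form (LocalRing p) g} = ⊤ := by
    rcases h with h | h
    · exact Ideal.eq_top_of_isUnit_mem _ (Ideal.subset_span (by simp))
        (isUnit_algebraMap (notMem_pointIdeal h))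
    · exact Ideal.eq_top_of_isUnit_mem _ (Ideal.subset_span (by simp))
        (isUnit_algebraMap (notMem_pointIdeal h))
  rw [intersectionMultiplicity, Module.length_eq_zero_iff, htop]
  exact Submodule.Quotient.subsingleton_iff.2 rfl

/-- A curve meets the union of two curves with multiplicity two at a point where it is transversal
to both. -/
theorem intersectionMultiplicity_eq_two {f g E E' a b c : Form} {p : Point} {m d d' : ℕ}
    (hf : f.IsHomogeneous m) (hE : E.IsHomogeneous d) (hE' : E'.IsHomogeneous d')
    (h : MeetTransversallyAt E f p) (h' : MeetTransversallyAt E' f p) (hp : Prime E)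
    (hd : ¬ E ∣ f) (ha : ¬ Passes a p) (hb : ¬ Passes b p)
    (hrel : c * f - a * g = b * (E * E')) : intersectionMultiplicity g f p = 2 := by
  have hau := isUnit_algebraMap (notMem_pointIdeal ha)
  have hbu := isUnit_algebraMap (notMem_pointIdeal hb)
  have hrel' := congrArg (algebraMap Form (LocalRing p)) hrel
  simp only [map_sub, map_mul] at hrel'
  -- Since `a` and `b` are units at `p`, the relation exchanges `g` for `E E'` modulo `f`.
  have hspan : Ideal.span {algebraMap Form (LocalRing p) g, algebraMap Form (LocalRing p) f} =
      Ideal.span {algebraMap Form (LocalRing p) f,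
        algebraMap Form (LocalRing p) E * algebraMap Form (LocalRing p) E'} := by
    refine le_antisymm ?_ ?_ <;> rw [Ideal.span_le, Set.insert_subset_iff, Set.singleton_subset_iff]
    · refine ⟨?_, Ideal.subset_span (by simp)⟩
      refine (Ideal.unit_mul_mem_iff_mem _ hau).1 (Ideal.mem_span_pair.2
        ⟨algebraMap Form (LocalRing p) c, -algebraMap Form (LocalRing p) b, ?_⟩)
      linear_combination hrel'
    · refine ⟨Ideal.subset_span (by simp), ?_⟩
      refine (Ideal.unit_mul_mem_iff_mem _ hbu).1 (Ideal.mem_span_pair.2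
        ⟨-algebraMap Form (LocalRing p) a, algebraMap Form (LocalRing p) c, ?_⟩)
      linear_combination hrel'
  rw [intersectionMultiplicity, hspan]
  exact length_quotient_span_mul
    ((map_ne_zero_iff _ (algebraMap_localRing_injective p)).2 hp.ne_zero)
    (span_eq_maximalIdeal hf hE h.symm) (span_eq_maximalIdeal hf hE' h'.symm)
    fun _ => algebraMap_dvd_of_dvd_mul (hp.irreducible.isRelPrime_iff_not_dvd.2 hd)

end PlaneCurve

/-! ### Local analysis of the contact -/

namespace Polycon

variable {n : ℕ} [NeZero n] {P P' : Polycon n} {k : Fin n} {α α' : Form} {e e' : ℕ}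

/-- At a residual point on the component `C i`, a nodal boundary splits into a smooth branch of
`C i` and its complement, and the adjoint curve is transversal to that branch. -/
theorem GoodAdjoint.exists_transversal_component (G : P.GoodAdjoint α e) (hnodal : P.IsNodal)
    {i : Fin n} {p : Point} (hi : Passes (P.c i) p) (hp : Passes α p) :
    ∃ E u : Form, ∃ δ : ℕ, P.c i = E * u ∧ E.IsHomogeneous δ ∧ Prime E ∧ ¬ E ∣ α ∧
      MeetTransversallyAt E (u * P.compl i) p ∧ MeetTransversallyAt E α p := by
  obtain ⟨E, u, δ, hEu, hE, hprime, hd, hEp, hup, htr⟩ := G.exists_component hi hp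
  have hb : P.boundary = E * (u * P.compl i) := by rw [← mul_assoc, ← hEu, P.c_mul_compl]
  have hnode := hnodal p (hb ▸ isSingularAt_mul hEp hup)
  rw [hb] at hnode
  have hm : MeetTransversallyAt E (u * P.compl i) p := ⟨hEp, hup, hnode.linearIndependent hEp hup⟩
  exact ⟨E, u, δ, hEu, hE, hprime, hd, hm, htr hm⟩

namespace IsLineReplacement

theorem not_passes_of_notMem (hrepl : P.IsLineReplacement P' k) (hnodal : P.IsNodal)
    (G : P.GoodAdjoint α e) (G' : P'.GoodAdjoint α' e') {p : Point}
    (hp : p ∉ P.residual ∩ P'.residual) : ¬ Passes α' p ∨ ¬ Passes α p := by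
  by_contra! hc
  obtain ⟨hα', hα⟩ := hc
  obtain ⟨r, μ, -, hμ, hrel⟩ := hrepl.exists_relation G G'
  have hα0 : eval p.rep α = 0 := hα
  have hα0' : eval p.rep α' = 0 := hα'
  have hg : Passes (P.compl k) p := by
    have h1 := congrArg (eval p.rep) hrel
    simp only [map_sub, map_mul, eval_C, hα0, hα0', zero_mul, mul_zero, sub_zero] at h1
    exact (mul_eq_zero.1 h1.symm).resolve_left hμ
  obtain ⟨i, hik, hi⟩ := passes_compl_iff.1 hg
  obtain ⟨E, u, δ, hEu, hE, hprime, hd, htr, htr'⟩ := G.exists_transversal_component hnodal hi hα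
  set w := ∏ a ∈ (Finset.univ.erase k).erase i, P.c a
  have hgE : P.compl k = E * (u * w) := by
    rw [P.exists_compl_eq hik.symm, hEu, mul_assoc]
  have hPi : P.compl i = P.c k * w := by
    rw [P.exists_compl_eq hik, Finset.erase_right_comm]
  -- The complement of the conic is `E (u w)`: it is singular at `p` when `u w` vanishes there, and
  -- then so are both boundaries.
  by_cases huw : Passes (u * w) p
  · have hgs : IsSingularAt (P.compl k) p := hgE ▸ isSingularAt_mul htr.1 huw
    have hsing : ∀ f : Form, IsSingularAt (f * P.compl k) p := by
      intro f
      refine ⟨by rw [mul_comm]; exact hgs.1.mul_left f, ?_⟩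
      rw [grad_eq_gradAt, gradAt_mul, ← grad_eq_gradAt (P.compl k), hgs.2,
        show eval p.rep (P.compl k) = 0 from hgs.1, zero_smul, smul_zero, add_zero]
    refine hp ⟨⟨P.c_mul_compl k ▸ hsing _, fun h => G.not_passes_of_mem_vertices h hα⟩,
      ⟨P'.c_mul_compl k ▸ hrepl.compl_eq ▸ hsing _, fun h => G'.not_passes_of_mem_vertices h hα'⟩⟩
  · have hck : eval p.rep (P.c k) = 0 := by
      have h1 := htr.2.1
      rw [hPi, passes_mul_iff, passes_mul_iff] at h1
      rw [passes_mul_iff] at huw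
      rcases h1 with h1 | h1 | h1
      · exact absurd (Or.inl h1) huw
      · exact h1
      · exact absurd (Or.inr h1) huw
    -- Both `α'` and the conic vanish at `p`, so their product has zero gradient. What remains says
    -- that a nonzero multiple of `grad E` is a multiple of `grad α`.
    have hgrad := congrArg (fun f => gradAt f p.rep) hrel
    have hsub : ∀ f g : Form, gradAt (f - g) p.rep = gradAt f p.rep - gradAt g p.rep := by
      intro f g; funext j; simp [gradAt]
    have hC : ∀ c : ℂ, gradAt (C c) p.rep = 0 := by
      intro c; funext j; simp [gradAt]
    simp only [hsub, gradAt_mul, hα0, hα0', hck, hC, zero_smul, smul_zero, add_zero, zero_add,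
      map_mul, eval_C, zero_mul, mul_zero, sub_zero, hgE, show eval p.rep E = 0 from htr.1] at hgrad
    obtain ⟨h1, -⟩ := LinearIndependent.pair_iff.1 htr'.2.2 (-(μ * eval p.rep (u * w)))
      (eval p.rep (P'.c k)) (by
        rw [grad_eq_gradAt, grad_eq_gradAt, hgrad, map_mul]
        module)
    exact mul_ne_zero hμ huw (neg_eq_zero.1 h1)

theorem isSmoothAt_and_intersectionMultiplicity (hrepl : P.IsLineReplacement P' k)
    (hnodal : P.IsNodal) (G : P.GoodAdjoint α e) (G' : P'.GoodAdjoint α' e') {p : Point}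
    (hp : p ∈ P.residual ∩ P'.residual) :
    IsSmoothAt α p ∧ intersectionMultiplicity α' α p = 2 := by
  obtain ⟨hp, hp'⟩ := hp
  obtain ⟨r, μ, hr, hμ, hrel⟩ := hrepl.exists_relation G G'
  have hα := G.passes_of_mem_residual hp
  -- If the conic passed through `p`, the complement would be smooth there by nodality. Singularity
  -- of the second boundary would then put `p` on the line too, hence at an explicit vertex.
  have hck : ¬ Passes (P.c k) p := by
    intro hck
    have hg := passes_compl_of_mem_residual hp hck
    have hnode := hnodal p hp.1
    rw [← P.c_mul_compl k] at hnode
    have hgrad := (hnode.linearIndependent hck hg).ne_zero 1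
    have hl : Passes (P'.c k) p := by
      have h2 := hp'.1.2
      rw [← P'.c_mul_compl k, hrepl.compl_eq, grad_eq_gradAt, gradAt_mul,
        show eval p.rep (P.compl k) = 0 from hg, zero_smul, add_zero, smul_eq_zero] at h2
      exact h2.resolve_right hgrad
    rcases hrepl.eq_or_eq G.sep hck hl with h | h
    · exact hp.2 (Or.inl ⟨_, h.symm⟩)
    · exact hp.2 (Or.inl ⟨_, h.symm⟩)
  obtain ⟨i, hi⟩ := passes_boundary_iff.1 hp.1.1
  have hik : i ≠ k := by rintro rfl; exact hck hi
  obtain ⟨j, hji, hj⟩ := passes_compl_iff.1 (passes_compl_of_mem_residual hp hi)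
  have hjk : j ≠ k := by rintro rfl; exact hck hj
  obtain ⟨E, u, δ, hEu, hE, hprime, hd, htr, hEα⟩ := G.exists_transversal_component hnodal hi hα
  obtain ⟨E', u', δ', hEu', hE', hprime', hd', htr', hEα'⟩ :=
    G.exists_transversal_component hnodal hj hα
  refine ⟨⟨hα, hEα.2.2.ne_zero 1⟩, ?_⟩
  set w := ∏ a ∈ ((Finset.univ.erase i).erase j), P.c a
  have hcompl : P.compl i = E' * (u' * w) := by
    rw [P.exists_compl_eq hji.symm, hEu', mul_assoc]
  -- A further factor through `p` would make the complement of `E` singular there, against the node.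
  have huw : ¬ Passes (u * (u' * w)) p := by
    intro h0
    refine htr.2.2.ne_zero 1 ?_
    have : u * P.compl i = E' * (u * (u' * w)) := by rw [hcompl]; ring
    change grad (u * P.compl i) p = 0
    rw [this]
    exact (isSingularAt_mul htr'.1 h0).2
  have hg : P.c k * P.compl k = u * (u' * w) * (E * E') := by
    rw [P.c_mul_compl, ← P.c_mul_compl i, hcompl, hEu]
    ring
  have hC : ∀ c : ℂ, c ≠ 0 → ¬ Passes (C c) p := fun c hc h => hc (by simpa [Passes] using h)
  -- The identity is multiplied by the conic, a unit at `p`, so that its right side becomes `μ`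
  -- times the whole boundary, from which `E` and `E'` split off. This accounts for the square of
  -- the conic in `a`.
  refine intersectionMultiplicity_eq_two (a := C r * P.c k * P.c k) (b := C μ * (u * (u' * w)))
    (c := P.c k * P'.c k) G.hom hE hE' hEα hEα' hprime hd ?_ ?_ ?_
  · rw [passes_mul_iff, passes_mul_iff]
    have := hC r hr
    tauto
  · rw [passes_mul_iff]
    have := hC μ hμ
    tauto
  · linear_combination P.c k * hrel + C μ * hg

end IsLineReplacement

end Polycon

/-! ### The theorem -/

theorem mainTheorem2 {n : ℕ} [NeZero n] (P P' : Polycon n) (k : Fin n)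
    (hnodal : P.IsNodal) (hsep : P.SeparatesVertices)
    (hrepl : P.IsLineReplacement P' k) (hfree : P'.ImplicitVerticesFree)
    (α α' : PlaneCurve.Form) (hα : P.IsAdjoint α) (hα' : P'.IsAdjoint α') :
    PlaneCurve.IsContactCurve α' α ∧
      ∃ hfin : (P.residual ∩ P'.residual).Finite,
        PlaneCurve.IsContactDivisor α' α (PlaneCurve.pointDivisor hfin.toFinset) := by
  obtain ⟨hα0, ⟨e, he, hhom⟩, hcond⟩ := hα
  obtain ⟨hα0', ⟨e', he', hhom'⟩, hcond'⟩ := hα'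
  have G : P.GoodAdjoint α e :=
    ⟨hsep, Polycon.implicitVerticesFree_of_isNodal hnodal, hα0, hhom, he, hcond⟩
  have G' : P'.GoodAdjoint α' e' :=
    ⟨hrepl.separatesVertices hsep, hfree, hα0', hhom', he', hcond'⟩
  have hfin : (P.residual ∩ P'.residual).Finite := by
    -- Residual points lie on `α` and on some boundary component, and each component meets `α` in
    -- finitely many points.
    refine (Set.finite_iUnion fun i => G.finite_setOf_passes i).subset fun p hp => ?_
    obtain ⟨i, hi⟩ := Polycon.passes_boundary_iff.1 hp.1.1.1
    exact Set.mem_iUnion.2 ⟨i, hi, G.passes_of_mem_residual hp.1⟩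
  have hdiv : IsContactDivisor α' α (pointDivisor hfin.toFinset) := by
    refine ⟨fun p hp => ?_, fun p => ?_⟩
    · have hp' : p ∈ hfin.toFinset := by
        by_contra h
        exact (Finsupp.mem_support_iff.1 hp) (pointDivisor_apply_of_notMem h)
      exact (hrepl.isSmoothAt_and_intersectionMultiplicity hnodal G G'
        (hfin.mem_toFinset.1 hp')).1
    · by_cases hp : p ∈ P.residual ∩ P'.residual
      · rw [pointDivisor_apply_of_mem (hfin.mem_toFinset.2 hp),
          (hrepl.isSmoothAt_and_intersectionMultiplicity hnodal G G' hp).2]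
        norm_num
      · rw [pointDivisor_apply_of_notMem fun h => hp (hfin.mem_toFinset.1 h),
          intersectionMultiplicity_eq_zero (hrepl.not_passes_of_notMem hnodal G G' hp)]
        norm_num
  exact ⟨⟨_, hdiv⟩, hfin, hdiv⟩
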